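/- Let $n>3$. Let $(M^*,g^*)$ be a smooth Riemannian manifold of dimension $n-1$, let $I\subset\mathbb R$ be a nonempty open interval and let $a:I\to(0,\infty)$ be smooth. The generalized Robertson-Walker (GRW) space-time $-I\times_a M^*$ is the $n$-dimensional Lorentzian manifold $I\times M^*$ with metric $g=-dt^2+a(t)^2g^*$. Let $u=\partial_t$, let $\nabla$, $\mathrm R_{kl}$ and $\mathrm C_{jklm}$ be the Levi-Civita connection, the Ricci tensor and the Weyl tensor of $g$, and put $\mathrm C_{kl}=u^ju^m\mathrm C_{jklm}$. The field $u$ is unit time-like ($u^ju_j=-1$), torse-forming ($\nabla_ju_k=\varphi(g_{jk}+u_ju_k)$ with $\varphi=\dot a/a$) and an eigenvector of the Ricci tensor ($\mathrm R_{kl}u^l=\xi u_k$ at every point, for some scalar $\xi$). Consider the following statements, each required to hold at every point of the space-time: (i) $\nabla^m\mathrm C_{jklm}=0$; (ii) $u^m\mathrm C_{jklm}=0$; (iii) $\mathrm C_{kl}=0$; (iv) $u^j\nabla^m\mathrm C_{jklm}=0$. If the scale function $a$ is not constant (equivalently, $\varphi$ is not identically zero), then (i), (ii), (iii) and (iv)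 are equivalent. In every GRW space-time, also when $a$ is constant, (ii) and (iii) are equivalent, (iii) implies (i), and (i) implies (iv). -/

import Mathlib

open scoped Manifold ContDiff

/-! ### Tensor calculus of a (pseudo-)Riemannian metric in coordinates

A metric on a coordinate domain is given by its component functions `G y i j = g_{ij}(y)`. -/

namespace CoordMetric

noncomputable section

variable {ι : Type*} [Fintype ι] [DecidableEq ι]

/-- The partial derivative `∂_i f` at `y`. -/
def partialDeriv (i : ι) (f : (ι → ℝ) → ℝ) (y : ι → ℝ) : ℝ :=
  fderiv ℝ f y (Pi.single i 1)

/-- The Christoffel symbol `Γ^k_{ij} = ½ g^{kl} (∂_i g_{jl} + ∂_j g_{il} - ∂_l g_{ij})`. -/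
def christoffel (G : (ι → ℝ) → Matrix ι ι ℝ) (k i j : ι) (y : ι → ℝ) : ℝ :=
  (1 / 2) * ∑ l, (G y)⁻¹ k l *
    (partialDeriv i (fun z => G z j l) y + partialDeriv j (fun z => G z i l) y
      - partialDeriv l (fun z => G z i j) y)

/-- The mixed Riemann tensor
`R^p_{klm} = ∂_l Γ^p_{mk} - ∂_m Γ^p_{lk} + Γ^p_{lq} Γ^q_{mk} - Γ^p_{mq} Γ^q_{lk}`. -/
def riemannMixed (G : (ι → ℝ) → Matrix ι ι ℝ) (p k l m : ι) (y : ι → ℝ) : ℝ :=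
  partialDeriv l (christoffel G p m k) y - partialDeriv m (christoffel G p l k) y
    + ∑ q, (christoffel G p l q y * christoffel G q m k y
        - christoffel G p m q y * christoffel G q l k y)

/-- The Riemann tensor with lowered indices, `R_{jklm} = g_{jp} R^p_{klm}`. -/
def riemann (G : (ι → ℝ) → Matrix ι ι ℝ) (j k l m : ι) (y : ι → ℝ) : ℝ :=
  ∑ p, G y j p * riemannMixed G p k l m y

/-- The Ricci tensor `R_{km} = R^p_{kpm}` (positive on round spheres). -/
def ricci (G : (ι → ℝ) → Matrix ι ι ℝ) (k m : ι) (y : ι → ℝ) : ℝ :=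
  ∑ p, riemannMixed G p k p m y

/-- The scalar curvature `R = g^{km} R_{km}`. -/
def scalarCurv (G : (ι → ℝ) → Matrix ι ι ℝ) (y : ι → ℝ) : ℝ :=
  ∑ k, ∑ m, (G y)⁻¹ k m * ricci G k m y

/-- The Weyl tensor `C_{jklm}` in dimension `n = card ι`. -/
def weyl (G : (ι → ℝ) → Matrix ι ι ℝ) (j k l m : ι) (y : ι → ℝ) : ℝ :=
  riemann G j k l m y
    - (1 / ((Fintype.card ι : ℝ) - 2)) *
        (G y j l * ricci G k m y - G y j m * ricci G k l y
          + G y k m * ricci G j l y - G y k l * ricci G j m y)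
    + (scalarCurv G y / (((Fintype.card ι : ℝ) - 1) * ((Fintype.card ι : ℝ) - 2))) *
        (G y j l * G y k m - G y j m * G y k l)

/-- The covariant derivative `∇_i w_j = ∂_i w_j - Γ^p_{ij} w_p` of a covector field. -/
def covDeriv₁ (G : (ι → ℝ) → Matrix ι ι ℝ) (w : ι → (ι → ℝ) → ℝ) (i j : ι)
    (y : ι → ℝ) : ℝ :=
  partialDeriv i (w j) y - ∑ p, christoffel G p i j y * w p y

/-- The covariant derivative `∇_i T_{jklm}` of a covariant tensor field of rank four. -/
def covDeriv₄ (G : (ι → ℝ) → Matrix ι ι ℝ) (T : ι → ι → ι → ι → (ι → ℝ) → ℝ)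
    (i j k l m : ι) (y : ι → ℝ) : ℝ :=
  partialDeriv i (T j k l m) y
    - ∑ p, (christoffel G p i j y * T p k l m y + christoffel G p i k y * T j p l m y
        + christoffel G p i l y * T j k p m y + christoffel G p i m y * T j k l p y)

/-- The divergence `∇^m C_{jklm} = g^{mi} ∇_i C_{jklm}` of the Weyl tensor. -/
def weylDiv (G : (ι → ℝ) → Matrix ι ι ℝ) (j k l : ι) (y : ι → ℝ) : ℝ :=
  ∑ m, ∑ i, (G y)⁻¹ m i * covDeriv₄ G (weyl G) i j k l m y

end

end CoordMetric

/-! ### Generalized Robertson-Walker space-times -/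

/-- The data of a generalized Robertson-Walker space-time `-I ×_a M*`: a nonempty open interval
`I`, a smooth positive scale function `a` on `I`, and a smooth Riemannian metric on the
`d`-dimensional smooth manifold `M = M*`. The space-time is the set of pairs `(t, p)` with `t ∈ I`
and `p ∈ M`; its dimension is `n = d + 1`. -/
structure GRWSpacetime (d : ℕ) (M : Type*) [TopologicalSpace M]
    [ChartedSpace (EuclideanSpace ℝ (Fin d)) M] [IsManifold (𝓡 d) ∞ M] where
  /-- the time interval -/
  I : Set ℝ
  isOpen_I : IsOpen I
  ordConnected_I : I.OrdConnected
  nonempty_I : I.Nonempty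
  /-- the scale function -/
  a : ℝ → ℝ
  contDiffOn_a : ContDiffOn ℝ ∞ a I
  a_pos : ∀ t ∈ I, 0 < a t
  /-- the Riemannian metric `g*` of the space factor -/
  gStar : Bundle.ContMDiffRiemannianMetric (𝓡 d) ∞ (EuclideanSpace ℝ (Fin d))
    (fun p : M => TangentSpace (𝓡 d) p)

namespace GRWSpacetime

noncomputable section

variable {d : ℕ} {M : Type*} [TopologicalSpace M]
  [ChartedSpace (EuclideanSpace ℝ (Fin d)) M] [IsManifold (𝓡 d) ∞ M]

/-- The Lorentzian metric `-dt² + a(t)² g*` at the event `(t, p)`, on tangent vectors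
`X = (X⁰, X*)` with `X⁰ ∈ ℝ` and `X* ∈ T_p M`. -/
def metric (S : GRWSpacetime d M) (t : ℝ) (p : M) (X Y : ℝ × TangentSpace (𝓡 d) p) : ℝ :=
  -(X.1 * Y.1) + S.a t ^ 2 * S.gStar.inner p X.2 Y.2

/-- The time coordinate of a coordinate point `y = (t, x¹, …, x^d)`. -/
def time (y : Fin (d + 1) → ℝ) : ℝ := y 0

/-- The spatial coordinates of a coordinate point `y = (t, x¹, …, x^d)`. -/
def space (y : Fin (d + 1) → ℝ) : EuclideanSpace ℝ (Fin d) :=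
  WithLp.toLp 2 (fun μ => y μ.succ)

/-- The coordinate domain in `ℝ^{d+1}` of the product chart given by `t` and a chart `e` of `M`. -/
def coordDomain (S : GRWSpacetime d M)
    (e : OpenPartialHomeomorph M (EuclideanSpace ℝ (Fin d))) : Set (Fin (d + 1) → ℝ) :=
  {y | time y ∈ S.I ∧ space y ∈ e.target}

/-- The coordinate frame `∂_0 = ∂_t`, `∂_{μ+1} = ∂/∂x^μ` of the product chart at the event with
coordinates `y`. -/
def coordFrame (e : OpenPartialHomeomorph M (EuclideanSpace ℝ (Fin d)))
    (y : Fin (d + 1) → ℝ) :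
    Fin (d + 1) → ℝ × TangentSpace (𝓡 d) (e.symm (space y)) :=
  Fin.cons (1, 0) (fun μ =>
    (0, mfderiv (𝓡 d) (𝓡 d) e.symm (space y) (EuclideanSpace.single μ (1 : ℝ))))

/-- The components `g_{ij}` of the space-time metric in the product chart. -/
def components (S : GRWSpacetime d M)
    (e : OpenPartialHomeomorph M (EuclideanSpace ℝ (Fin d)))
    (y : Fin (d + 1) → ℝ) : Matrix (Fin (d + 1)) (Fin (d + 1)) ℝ :=
  Matrix.of fun i j =>
    S.metric (time y) (e.symm (space y)) (coordFrame e y i) (coordFrame e y j)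

/-- The contravariant components `u^j` of the velocity field `u = ∂_t`. -/
def u (j : Fin (d + 1)) : ℝ := if j = 0 then 1 else 0

/-- The covariant components `u_k = g_{kj} u^j` of the velocity field. -/
def uLower (S : GRWSpacetime d M) (e : OpenPartialHomeomorph M (EuclideanSpace ℝ (Fin d)))
    (k : Fin (d + 1)) (y : Fin (d + 1) → ℝ) : ℝ :=
  ∑ j, S.components e y k j * u j

/-- A property of tensor components holds at every event of the space-time, in every product chart
built from a smooth chart of `M`. -/
def Everywhere (S : GRWSpacetime d M)
    (P : OpenPartialHomeomorph M (EuclideanSpace ℝ (Fin d)) → (Fin (d + 1) → ℝ) → Prop) : Prop :=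
  ∀ e ∈ IsManifold.maximalAtlas (𝓡 d) ∞ M, ∀ y ∈ S.coordDomain e, P e y

/-- `u^j u_j = -1`. -/
def UnitTimelike (S : GRWSpacetime d M) : Prop :=
  S.Everywhere fun e y => ∑ j, u j * S.uLower e j y = -1

/-- `∇_j u_k = φ (g_{jk} + u_j u_k)` with `φ = a' / a`. -/
def TorseForming (S : GRWSpacetime d M) : Prop :=
  S.Everywhere fun e y => ∀ j k,
    CoordMetric.covDeriv₁ (S.components e) (S.uLower e) j k y =
      (deriv S.a (time y) / S.a (time y)) *
        (S.components e y j k + S.uLower e j y * S.uLower e k y)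

/-- `R_{kl} u^l = ξ u_k` for some scalar `ξ`. -/
def RicciEigenvector (S : GRWSpacetime d M) : Prop :=
  S.Everywhere fun e y => ∃ ξ : ℝ, ∀ k,
    ∑ l, CoordMetric.ricci (S.components e) k l y * u l = ξ * S.uLower e k y

/-- `∇^m C_{jklm} = 0`. -/
def WeylDivFree (S : GRWSpacetime d M) : Prop :=
  S.Everywhere fun e y => ∀ j k l, CoordMetric.weylDiv (S.components e) j k l y = 0

/-- `u^m C_{jklm} = 0`. -/
def WeylAnnihilated (S : GRWSpacetime d M) : Prop :=
  S.Everywhere fun e y => ∀ j k l, ∑ m, u m * CoordMetric.weyl (S.components e) j k l m y = 0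

/-- `C_{kl} = u^j u^m C_{jklm} = 0`. -/
def ContractedWeylZero (S : GRWSpacetime d M) : Prop :=
  S.Everywhere fun e y => ∀ k l,
    ∑ j, ∑ m, u j * u m * CoordMetric.weyl (S.components e) j k l m y = 0

/-- `u^j ∇^m C_{jklm} = 0`. -/
def ContractedWeylDivZero (S : GRWSpacetime d M) : Prop :=
  S.Everywhere fun e y => ∀ k l,
    ∑ j, u j * CoordMetric.weylDiv (S.components e) j k l y = 0

end

end GRWSpacetime

/-!
Every product chart of the space-time has the block metric `-dt² + a(t)² h(x)`, where `h` is a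
smooth, symmetric, invertible matrix function: the components of `g*` in a chart of `M*`
(`GRWSpacetime.components_eq`, `GRWSpacetime.isMetricOn_spatialComponents`). The theorem is then a
coordinate computation for warped products.

Let `φ = a' / a`, let `d = n - 1`, and let `F = (Ric* - (R* / d) h) / (d - 1)` be the normalized
trace-free Ricci tensor of `h`. All derivatives of `a` cancel in the Weyl tensor: its
components with a time index are all `0` or `±F`, and its purely spatial components are `a² W`,
where `W` is a tensor of `h` alone (`weyl_zero_succ_zero_succ`, `weyl_succ_succ_succ_succ`). Hence
both `u^m C_{jklm} = 0` and `C_{kl} = 0` say that `F = 0`, i.e. that `h` is Einstein.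

Suppose `F = 0`. Then the components of `∇^m C_{jklm}` with a time index vanish by the symmetries of
the Weyl tensor, and the spatial ones are the divergence of `W`. The contracted Bianchi
identity (`IsMetricOn.div_riemann`) and Schur's lemma (`IsMetricOn.partialDeriv_einstein_factor`,
where `d ≥ 3` enters) make it vanish (`IsMetricOn.div_spatialWeyl`, `IsWarpedOn.weylDiv_eq_zero`).

Conversely, `u^j ∇^m C_{jklm} = (d - 2) φ F` (`IsWarpedOn.weylDiv_zero_succ_succ`). As `F` does not
depend on time, one time with `φ ≠ 0` is enough to conclude `F = 0` at all events.

The curvature identities are proved in matrix form: with connection matrices `(A_i)^p_k = Γ^p_{ik}`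
the curvature is `R_{lm} = ∂_l A_m - ∂_m A_l + [A_l, A_m]` and metric compatibility reads
`∂_i G = A_iᵀ G + G A_i`, so that the skew symmetry of the lowered curvature and the second Bianchi
identity become identities in a noncommutative ring.
-/

set_option linter.unusedSectionVars false

/-! ### Partial derivatives and the curvature of a metric in coordinates -/

namespace CoordMetric

open scoped Topology
open Finset Matrix

variable {ι : Type*} [Fintype ι] [DecidableEq ι]
variable {U : Set (ι → ℝ)} {f g : (ι → ℝ) → ℝ} {y : ι → ℝ}

theorem partialDeriv_congr (hU : IsOpen U) (hy : y ∈ U) (h : Set.EqOn f g U) (i : ι) :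
    partialDeriv i f y = partialDeriv i g y := by
  unfold partialDeriv
  rw [Filter.EventuallyEq.fderiv_eq (Filter.eventuallyEq_of_mem (hU.mem_nhds hy) h)]

theorem differentiableAt_of_contDiffOn (hU : IsOpen U) (hf : ContDiffOn ℝ ∞ f U) (hy : y ∈ U) :
    DifferentiableAt ℝ f y :=
  (hf.contDiffAt (hU.mem_nhds hy)).differentiableAt (by simp)

theorem contDiffOn_partialDeriv (hU : IsOpen U) (hf : ContDiffOn ℝ ∞ f U) (i : ι) :
    ContDiffOn ℝ ∞ (partialDeriv i f) U :=
  (hf.fderiv_of_isOpen hU (by simp)).clm_apply contDiffOn_const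

@[simp] theorem partialDeriv_const (i : ι) (c : ℝ) : partialDeriv i (fun _ => c) y = 0 := by
  simp [partialDeriv]

theorem partialDeriv_add (hf : DifferentiableAt ℝ f y) (hg : DifferentiableAt ℝ g y) (i : ι) :
    partialDeriv i (fun z => f z + g z) y = partialDeriv i f y + partialDeriv i g y := by
  simp [partialDeriv, fderiv_fun_add hf hg]

theorem partialDeriv_sub (hf : DifferentiableAt ℝ f y) (hg : DifferentiableAt ℝ g y) (i : ι) :
    partialDeriv i (fun z => f z - g z) y = partialDeriv i f y - partialDeriv i g y := by
  simp [partialDeriv, fderiv_fun_sub hf hg]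

theorem partialDeriv_neg (i : ι) :
    partialDeriv i (fun z => -f z) y = -partialDeriv i f y := by
  simp [partialDeriv, fderiv_fun_neg]

theorem partialDeriv_mul (hf : DifferentiableAt ℝ f y) (hg : DifferentiableAt ℝ g y) (i : ι) :
    partialDeriv i (fun z => f z * g z) y =
      partialDeriv i f y * g y + f y * partialDeriv i g y := by
  simp [partialDeriv, fderiv_fun_mul hf hg]; ring

theorem partialDeriv_sum {κ : Type*} {s : Finset κ} {f : κ → (ι → ℝ) → ℝ}
    (hf : ∀ a ∈ s, DifferentiableAt ℝ (f a) y) (i : ι) :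
    partialDeriv i (fun z => ∑ a ∈ s, f a z) y = ∑ a ∈ s, partialDeriv i (f a) y := by
  simp [partialDeriv, fderiv_fun_sum hf]

theorem partialDeriv_comm (hU : IsOpen U) (hf : ContDiffOn ℝ ∞ f U) (hy : y ∈ U) (i j : ι) :
    partialDeriv i (partialDeriv j f) y = partialDeriv j (partialDeriv i f) y := by
  have hc : ContDiffAt ℝ ∞ f y := hf.contDiffAt (hU.mem_nhds hy)
  have hd : DifferentiableAt ℝ (fderiv ℝ f) y :=
    (hc.fderiv_right (m := 1) (by norm_cast)).differentiableAt (by simp)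
  have key : ∀ a b : ι, partialDeriv a (partialDeriv b f) y
      = fderiv ℝ (fderiv ℝ f) y (Pi.single a 1) (Pi.single b 1) := by
    intro a b
    unfold partialDeriv
    rw [fderiv_clm_apply hd (differentiableAt_const _)]
    simp
  rw [key, key]
  exact (hc.isSymmSndFDerivAt (by simp; norm_cast)) _ _

/-- The entrywise partial derivative `∂_i F` of a matrix-valued function. -/
noncomputable def matDeriv (i : ι) (F : (ι → ℝ) → Matrix ι ι ℝ) (y : ι → ℝ) : Matrix ι ι ℝ :=
  Matrix.of fun p k => partialDeriv i (fun z => F z p k) y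

/-- Smoothness of all the entries of a matrix-valued function on a set. -/
def MatSmoothOn (F : (ι → ℝ) → Matrix ι ι ℝ) (U : Set (ι → ℝ)) : Prop :=
  ∀ p k, ContDiffOn ℝ ∞ (fun z => F z p k) U

section MatDeriv

variable {F H : (ι → ℝ) → Matrix ι ι ℝ}

theorem MatSmoothOn.mul (hF : MatSmoothOn F U) (hH : MatSmoothOn H U) :
    MatSmoothOn (fun z => F z * H z) U := fun p k => by
  simp only [Matrix.mul_apply]
  exact ContDiffOn.sum fun q _ => (hF p q).mul (hH q k)

theorem MatSmoothOn.add (hF : MatSmoothOn F U) (hH : MatSmoothOn H U) :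
    MatSmoothOn (fun z => F z + H z) U := fun p k => (hF p k).add (hH p k)

theorem MatSmoothOn.sub (hF : MatSmoothOn F U) (hH : MatSmoothOn H U) :
    MatSmoothOn (fun z => F z - H z) U := fun p k => (hF p k).sub (hH p k)

theorem MatSmoothOn.transpose (hF : MatSmoothOn F U) :
    MatSmoothOn (fun z => (F z)ᵀ) U := fun p k => hF k p

theorem MatSmoothOn.matDeriv (hU : IsOpen U) (hF : MatSmoothOn F U) (i : ι) :
    MatSmoothOn (matDeriv i F) U := fun p k => contDiffOn_partialDeriv hU (hF p k) i

theorem MatSmoothOn.differentiableAt (hU : IsOpen U) (hF : MatSmoothOn F U) (hy : y ∈ U) (p k : ι) :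
    DifferentiableAt ℝ (fun z => F z p k) y :=
  differentiableAt_of_contDiffOn hU (hF p k) hy

theorem matDeriv_congr (hU : IsOpen U) (hy : y ∈ U) (h : Set.EqOn F H U) (i : ι) :
    matDeriv i F y = matDeriv i H y := by
  ext p k
  exact partialDeriv_congr hU hy (fun z hz => by simp [h hz]) i

theorem matDeriv_mul (hU : IsOpen U) (hF : MatSmoothOn F U) (hH : MatSmoothOn H U) (hy : y ∈ U)
    (i : ι) : matDeriv i (fun z => F z * H z) y = matDeriv i F y * H y + F y * matDeriv i H y := by
  ext p k
  have hd := hF.differentiableAt hU hy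
  have hd' := hH.differentiableAt hU hy
  simp only [matDeriv, Matrix.of_apply, Matrix.mul_apply, Matrix.add_apply]
  rw [partialDeriv_sum (f := fun q z => F z p q * H z q k)
    (fun q _ => (hd p q).fun_mul (hd' q k)), ← Finset.sum_add_distrib]
  exact Finset.sum_congr rfl fun q _ => partialDeriv_mul (hd p q) (hd' q k) i

theorem matDeriv_add (hU : IsOpen U) (hF : MatSmoothOn F U) (hH : MatSmoothOn H U) (hy : y ∈ U)
    (i : ι) : matDeriv i (fun z => F z + H z) y = matDeriv i F y + matDeriv i H y := by
  ext p k
  exact partialDeriv_add (hF.differentiableAt hU hy p k) (hH.differentiableAt hU hy p k) i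

theorem matDeriv_sub (hU : IsOpen U) (hF : MatSmoothOn F U) (hH : MatSmoothOn H U) (hy : y ∈ U)
    (i : ι) : matDeriv i (fun z => F z - H z) y = matDeriv i F y - matDeriv i H y := by
  ext p k
  exact partialDeriv_sub (hF.differentiableAt hU hy p k) (hH.differentiableAt hU hy p k) i

theorem matDeriv_transpose (i : ι) :
    matDeriv i (fun z => (F z)ᵀ) y = (matDeriv i F y)ᵀ := rfl

theorem matDeriv_comm (hU : IsOpen U) (hF : MatSmoothOn F U) (hy : y ∈ U) (i j : ι) :
    matDeriv i (matDeriv j F) y = matDeriv j (matDeriv i F) y := by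
  ext p k
  exact partialDeriv_comm hU (hF p k) hy i j

end MatDeriv

/-- `G` is a smooth symmetric nondegenerate metric on the coordinate domain `U`. -/
structure IsMetricOn (G : (ι → ℝ) → Matrix ι ι ℝ) (U : Set (ι → ℝ)) : Prop where
  isOpen : IsOpen U
  smooth : MatSmoothOn G U
  symm : ∀ y ∈ U, (G y)ᵀ = G y
  isUnit_det : ∀ y ∈ U, IsUnit (G y).det

/-- The connection matrix `A_i`, with entries `(A_i)^p_k = Γ^p_{ik}`. -/
noncomputable def connMatrix (G : (ι → ℝ) → Matrix ι ι ℝ) (i : ι) (y : ι → ℝ) : Matrix ι ι ℝ :=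
  Matrix.of fun p k => christoffel G p i k y

/-- The curvature matrix `R_{lm} = ∂_l A_m - ∂_m A_l + [A_l, A_m]`, with entries `R^p_{klm}`. -/
noncomputable def curvMatrix (G : (ι → ℝ) → Matrix ι ι ℝ) (l m : ι) (y : ι → ℝ) :
    Matrix ι ι ℝ :=
  Matrix.of fun p k => riemannMixed G p k l m y

theorem curvMatrix_eq (G : (ι → ℝ) → Matrix ι ι ℝ) (l m : ι) (y : ι → ℝ) :
    curvMatrix G l m y = matDeriv l (connMatrix G m) y - matDeriv m (connMatrix G l) y
      + (connMatrix G l y * connMatrix G m y - connMatrix G m y * connMatrix G l y) := by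
  ext p k
  simp [curvMatrix, connMatrix, matDeriv, riemannMixed, Matrix.mul_apply, Finset.sum_sub_distrib]

theorem curvMatrix_swap (G : (ι → ℝ) → Matrix ι ι ℝ) (l m : ι) (y : ι → ℝ) :
    curvMatrix G m l y = -curvMatrix G l m y := by
  rw [curvMatrix_eq, curvMatrix_eq]; abel

theorem riemannMixed_swap (G : (ι → ℝ) → Matrix ι ι ℝ) (p k l m : ι) (y : ι → ℝ) :
    riemannMixed G p k m l y = -riemannMixed G p k l m y :=
  congrFun₂ (curvMatrix_swap G l m y) p k

theorem riemann_swap_right (G : (ι → ℝ) → Matrix ι ι ℝ) (j k l m : ι) (y : ι → ℝ) :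
    riemann G j k m l y = -riemann G j k l m y := by
  simp [riemann, riemannMixed_swap G _ k l m]

theorem riemann_eq_mul (G : (ι → ℝ) → Matrix ι ι ℝ) (j k l m : ι) (y : ι → ℝ) :
    riemann G j k l m y = (G y * curvMatrix G l m y) j k := by
  simp [riemann, curvMatrix, Matrix.mul_apply]

/-- The covariant derivative `∇_i R^p_{klm}`, as a matrix in `p, k`. -/
noncomputable def covCurv (G : (ι → ℝ) → Matrix ι ι ℝ) (i l m : ι)
    (y : ι → ℝ) : Matrix ι ι ℝ :=
  matDeriv i (curvMatrix G l m) y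
    + (connMatrix G i y * curvMatrix G l m y - curvMatrix G l m y * connMatrix G i y)
    - ∑ q, (christoffel G q i l y • curvMatrix G q m y + christoffel G q i m y • curvMatrix G l q y)

namespace IsMetricOn

variable {G : (ι → ℝ) → Matrix ι ι ℝ}

theorem apply_comm (hG : IsMetricOn G U) (hy : y ∈ U) (i j : ι) : G y i j = G y j i :=
  congrFun₂ (hG.symm y hy) j i

theorem inv_apply_comm (hG : IsMetricOn G U) (hy : y ∈ U) (i j : ι) :
    (G y)⁻¹ i j = (G y)⁻¹ j i := by
  have h : ((G y)⁻¹)ᵀ = (G y)⁻¹ := by rw [Matrix.transpose_nonsing_inv, hG.symm y hy]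
  exact congrFun₂ h j i

theorem smooth_inv (hG : IsMetricOn G U) : MatSmoothOn (fun z => (G z)⁻¹) U := by
  have hdet : ∀ F : (ι → ℝ) → Matrix ι ι ℝ, MatSmoothOn F U →
      ContDiffOn ℝ ∞ (fun z => (F z).det) U := by
    intro F hF
    simp only [Matrix.det_apply]
    refine ContDiffOn.sum fun σ _ => ContDiffOn.const_smul _ ?_
    exact contDiffOn_prod fun i _ => hF _ _
  intro p k
  have h1 : (fun z => (G z)⁻¹ p k)
      = fun z => ((G z).det)⁻¹ * ((G z).updateRow k (Pi.single p 1)).det := by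
    funext z
    rw [Matrix.inv_def, Matrix.smul_apply, Matrix.adjugate_apply, Ring.inverse_eq_inv', smul_eq_mul]
  rw [h1]
  refine ((hdet G hG.smooth).inv fun z hz => (hG.isUnit_det z hz).ne_zero).mul (hdet _ ?_)
  intro i j
  by_cases hi : i = k
  · subst hi
    simpa using contDiffOn_const
  · simpa [Matrix.updateRow_apply, hi] using hG.smooth i j

theorem smooth_christoffel (hG : IsMetricOn G U) (k i j : ι) :
    ContDiffOn ℝ ∞ (christoffel G k i j) U := by
  unfold christoffel
  refine contDiffOn_const.mul (ContDiffOn.sum fun l _ => (hG.smooth_inv k l).mul ?_)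
  exact ((contDiffOn_partialDeriv hG.isOpen (hG.smooth _ _) _).add
    (contDiffOn_partialDeriv hG.isOpen (hG.smooth _ _) _)).sub
    (contDiffOn_partialDeriv hG.isOpen (hG.smooth _ _) _)

theorem smooth_connMatrix (hG : IsMetricOn G U) (i : ι) : MatSmoothOn (connMatrix G i) U :=
  fun p k => hG.smooth_christoffel p i k

theorem smooth_curvMatrix (hG : IsMetricOn G U) (l m : ι) : MatSmoothOn (curvMatrix G l m) U := by
  have h := fun i => hG.smooth_connMatrix i
  have e : curvMatrix G l m = fun y => matDeriv l (connMatrix G m) y - matDeriv m (connMatrix G l) y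
      + (connMatrix G l y * connMatrix G m y - connMatrix G m y * connMatrix G l y) :=
    funext fun y => curvMatrix_eq G l m y
  rw [e]
  exact (((h m).matDeriv hG.isOpen l).sub ((h l).matDeriv hG.isOpen m)).add
    (((h l).mul (h m)).sub ((h m).mul (h l)))

theorem smooth_riemannMixed (hG : IsMetricOn G U) (p k l m : ι) :
    ContDiffOn ℝ ∞ (riemannMixed G p k l m) U := hG.smooth_curvMatrix l m p k

theorem smooth_ricci (hG : IsMetricOn G U) (k m : ι) : ContDiffOn ℝ ∞ (ricci G k m) U :=
  ContDiffOn.sum fun p _ => hG.smooth_riemannMixed p k p m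

theorem smooth_riemann (hG : IsMetricOn G U) (j k l m : ι) :
    ContDiffOn ℝ ∞ (riemann G j k l m) U :=
  ContDiffOn.sum fun p _ => (hG.smooth j p).mul (hG.smooth_riemannMixed p k l m)

theorem smooth_scalarCurv (hG : IsMetricOn G U) : ContDiffOn ℝ ∞ (scalarCurv G) U :=
  ContDiffOn.sum fun k _ => ContDiffOn.sum fun m _ => (hG.smooth_inv k m).mul (hG.smooth_ricci k m)

theorem partialDeriv_apply_comm (hG : IsMetricOn G U) (hy : y ∈ U) (l i j : ι) :
    partialDeriv l (fun z => G z i j) y = partialDeriv l (fun z => G z j i) y :=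
  partialDeriv_congr hG.isOpen hy (fun _ hz => hG.apply_comm hz i j) l

theorem christoffel_comm (hG : IsMetricOn G U) (hy : y ∈ U) (k i j : ι) :
    christoffel G k i j y = christoffel G k j i y := by
  unfold christoffel
  congr 1
  refine Finset.sum_congr rfl fun l _ => ?_
  rw [hG.partialDeriv_apply_comm hy l i j]
  ring

theorem mul_inv_cancel (hG : IsMetricOn G U) (hy : y ∈ U) : G y * (G y)⁻¹ = 1 :=
  Matrix.mul_nonsing_inv _ (hG.isUnit_det y hy)

theorem inv_mul_cancel (hG : IsMetricOn G U) (hy : y ∈ U) : (G y)⁻¹ * G y = 1 :=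
  Matrix.nonsing_inv_mul _ (hG.isUnit_det y hy)

theorem sum_inv_mul (hG : IsMetricOn G U) (hy : y ∈ U) (i k : ι) :
    ∑ j, (G y)⁻¹ i j * G y j k = if i = k then 1 else 0 := by
  have := congrFun₂ (hG.inv_mul_cancel hy) i k
  rwa [Matrix.mul_apply, Matrix.one_apply] at this

theorem sum_mul_inv (hG : IsMetricOn G U) (hy : y ∈ U) (i k : ι) :
    ∑ j, G y i j * (G y)⁻¹ j k = if i = k then 1 else 0 := by
  have := congrFun₂ (hG.mul_inv_cancel hy) i k
  rwa [Matrix.mul_apply, Matrix.one_apply] at this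

/-- The Christoffel symbols of the first kind, `g_{qk} Γ^k_{ij}`. -/
theorem sum_mul_christoffel (hG : IsMetricOn G U) (hy : y ∈ U) (q i j : ι) :
    ∑ k, G y q k * christoffel G k i j y = (1 / 2) * (partialDeriv i (fun z => G z j q) y
      + partialDeriv j (fun z => G z i q) y - partialDeriv q (fun z => G z i j) y) := by
  have h : ∀ v : ι → ℝ, ∑ k, G y q k * ((1 / 2) * ∑ l, (G y)⁻¹ k l * v l) = (1 / 2) * v q := by
    intro v
    have h2 : G y *ᵥ ((G y)⁻¹ *ᵥ v) = v := by
      rw [Matrix.mulVec_mulVec, hG.mul_inv_cancel hy, Matrix.one_mulVec]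
    have h3 := congrFun h2 q
    simp only [Matrix.mulVec, dotProduct] at h3
    rw [← h3, Finset.mul_sum]
    exact Finset.sum_congr rfl fun k _ => by ring
  exact h fun l => partialDeriv i (fun z => G z j l) y
      + partialDeriv j (fun z => G z i l) y - partialDeriv l (fun z => G z i j) y

/-- The Levi-Civita connection is metric: `∂_i G = A_iᵀ G + G A_i`. -/
theorem matDeriv_metric (hG : IsMetricOn G U) (hy : y ∈ U) (i : ι) :
    matDeriv i G y = (connMatrix G i y)ᵀ * G y + G y * connMatrix G i y := by
  ext j k
  have h1 := hG.sum_mul_christoffel hy k i j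
  have h2 := hG.sum_mul_christoffel hy j i k
  rw [Matrix.add_apply, Matrix.mul_apply, Matrix.mul_apply]
  simp only [matDeriv, connMatrix, Matrix.of_apply, Matrix.transpose_apply]
  rw [h2, Finset.sum_congr rfl fun p _ => show christoffel G p i j y * G y p k
    = G y k p * christoffel G p i j y by rw [hG.apply_comm hy p k, mul_comm], h1,
    hG.partialDeriv_apply_comm hy i k j]
  ring

theorem partialDeriv_metric (hG : IsMetricOn G U) (hy : y ∈ U) (i j k : ι) :
    partialDeriv i (fun z => G z j k) y
      = ∑ p, (christoffel G p i j y * G y p k + christoffel G p i k y * G y j p) := by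
  have h := congrFun₂ (hG.matDeriv_metric hy i) j k
  simp only [Matrix.add_apply, Matrix.mul_apply, matDeriv, connMatrix, Matrix.of_apply,
    Matrix.transpose_apply] at h
  rw [h, Finset.sum_add_distrib]
  congr 1
  exact Finset.sum_congr rfl fun p _ => mul_comm _ _

/-- `R_{jklm}` is skew in `j, k`: apply `∂_l ∂_m G = ∂_m ∂_l G` to `∂_i G = A_iᵀ G + G A_i`. -/
theorem curvMatrix_skew (hG : IsMetricOn G U) (hy : y ∈ U) (l m : ι) :
    (curvMatrix G l m y)ᵀ * G y + G y * curvMatrix G l m y = 0 := by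
  have hU := hG.isOpen
  have hA := hG.smooth_connMatrix
  have key : ∀ l m, matDeriv l (matDeriv m G) y
      = (matDeriv l (connMatrix G m) y)ᵀ * G y
        + (connMatrix G m y)ᵀ * ((connMatrix G l y)ᵀ * G y + G y * connMatrix G l y)
        + (((connMatrix G l y)ᵀ * G y + G y * connMatrix G l y) * connMatrix G m y
        + G y * matDeriv l (connMatrix G m) y) := by
    intro l m
    rw [matDeriv_congr hU hy (fun z hz => hG.matDeriv_metric hz m) l,
      matDeriv_add hU ((hA m).transpose.mul hG.smooth) (hG.smooth.mul (hA m)) hy,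
      matDeriv_mul hU (hA m).transpose hG.smooth hy, matDeriv_mul hU hG.smooth (hA m) hy,
      hG.matDeriv_metric hy l, matDeriv_transpose]
  have h := matDeriv_comm hU hG.smooth hy l m
  rw [key, key, ← sub_eq_zero] at h
  rw [curvMatrix_eq, ← h]
  simp only [Matrix.transpose_add, Matrix.transpose_sub, Matrix.transpose_mul]
  noncomm_ring

theorem riemann_swap_left (hG : IsMetricOn G U) (hy : y ∈ U) (j k l m : ι) :
    riemann G k j l m y = -riemann G j k l m y := by
  have h := congrFun₂ (hG.curvMatrix_skew hy l m) j k
  have h2 : ((curvMatrix G l m y)ᵀ * G y) j k = riemann G k j l m y := by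
    simp only [Matrix.mul_apply, riemann, curvMatrix, Matrix.of_apply, Matrix.transpose_apply]
    exact Finset.sum_congr rfl fun p _ => by rw [hG.apply_comm hy p k, mul_comm]
  rw [Matrix.add_apply, h2, ← riemann_eq_mul, Matrix.zero_apply] at h
  linarith

theorem riemannMixed_cyclic (hG : IsMetricOn G U) (hy : y ∈ U) (p k l m : ι) :
    riemannMixed G p k l m y + riemannMixed G p l m k y + riemannMixed G p m k l y = 0 := by
  have hs : ∀ a i j, Set.EqOn (christoffel G a i j) (christoffel G a j i) U :=
    fun a i j z hz => hG.christoffel_comm hz a i j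
  unfold riemannMixed
  rw [partialDeriv_congr hG.isOpen hy (hs p m k), partialDeriv_congr hG.isOpen hy (hs p l k),
    partialDeriv_congr hG.isOpen hy (hs p m l)]
  have : ∀ a b c : ι, (∑ q, (christoffel G p a q y * christoffel G q b c y
      - christoffel G p b q y * christoffel G q a c y))
      = (∑ q, christoffel G p a q y * christoffel G q b c y)
      - ∑ q, christoffel G p b q y * christoffel G q a c y := fun a b c => Finset.sum_sub_distrib _ _
  rw [this, this, this]
  simp only [hG.christoffel_comm hy _ m k, hG.christoffel_comm hy _ l k,
    hG.christoffel_comm hy _ m l]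
  ring

theorem riemann_cyclic (hG : IsMetricOn G U) (hy : y ∈ U) (j k l m : ι) :
    riemann G j k l m y + riemann G j l m k y + riemann G j m k l y = 0 := by
  unfold riemann
  rw [← Finset.sum_add_distrib, ← Finset.sum_add_distrib]
  refine Finset.sum_eq_zero fun p _ => ?_
  rw [← mul_add, ← mul_add, hG.riemannMixed_cyclic hy, mul_zero]

/-- A linear consequence of the skew symmetries and of the cyclic identity at four index orders. -/
theorem riemann_pair_symm (hG : IsMetricOn G U) (hy : y ∈ U) (j k l m : ι) :
    riemann G j k l m y = riemann G l m j k y := by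
  have c := hG.riemann_cyclic hy
  have a := hG.riemann_swap_left hy
  have b := fun j k l m => riemann_swap_right G j k l m y
  linarith [c j k l m, c k l m j, c l m j k, c m j k l, a j k l m, a k l m j, a l m j k, a m j k l,
    a j l m k, b j l m k, a k m j l, b k m j l, b j k l m, b k l m j, b l m j k, b m j k l,
    a k j l m, a j k m l, a l k j m, b l k j m, a l j k m, b l j k m, a j m k l, b j m k l,
    a k m l j, a k j m l, b k j m l, a k l j m, a j l k m, a l m k j, b k l j m, b k j l m,
    a m k l j, b m k l j, a l k m j, b l k m j, a m l j k, b m l j k]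

/-- The second Bianchi identity. With `R = dA + A ∧ A` the derivative and commutator terms cancel
in the cyclic sum, and the remaining Christoffel terms cancel by the symmetry of `Γ`. -/
theorem covCurv_cyclic (hG : IsMetricOn G U) (hy : y ∈ U) (i l m : ι) :
    covCurv G i l m y + covCurv G l m i y + covCurv G m i l y = 0 := by
  have hU := hG.isOpen
  have hA := hG.smooth_connMatrix
  have hd : ∀ i l m, matDeriv i (curvMatrix G l m) y
      = matDeriv i (matDeriv l (connMatrix G m)) y - matDeriv i (matDeriv m (connMatrix G l)) y
        + ((matDeriv i (connMatrix G l) y * connMatrix G m y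
            + connMatrix G l y * matDeriv i (connMatrix G m) y)
          - (matDeriv i (connMatrix G m) y * connMatrix G l y
            + connMatrix G m y * matDeriv i (connMatrix G l) y)) := by
    intro i l m
    have hAd := fun a b => (hA a).matDeriv hU b
    rw [matDeriv_congr hU hy (fun z _ => curvMatrix_eq G l m z) i,
      matDeriv_add hU ((hAd m l).sub (hAd l m)) (((hA l).mul (hA m)).sub ((hA m).mul (hA l))) hy,
      matDeriv_sub hU (hAd m l) (hAd l m) hy,
      matDeriv_sub hU ((hA l).mul (hA m)) ((hA m).mul (hA l)) hy,
      matDeriv_mul hU (hA l) (hA m) hy, matDeriv_mul hU (hA m) (hA l) hy]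
  have hsum : (∑ q, (christoffel G q i l y • curvMatrix G q m y
        + christoffel G q i m y • curvMatrix G l q y))
      + (∑ q, (christoffel G q l m y • curvMatrix G q i y
        + christoffel G q l i y • curvMatrix G m q y))
      + (∑ q, (christoffel G q m i y • curvMatrix G q l y
        + christoffel G q m l y • curvMatrix G i q y)) = 0 := by
    rw [← Finset.sum_add_distrib, ← Finset.sum_add_distrib]
    refine Finset.sum_eq_zero fun q _ => ?_
    rw [hG.christoffel_comm hy q l i, hG.christoffel_comm hy q m i, hG.christoffel_comm hy q m l,
      curvMatrix_swap G m q, curvMatrix_swap G l q, curvMatrix_swap G i q]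
    simp only [smul_neg]
    abel
  have hmain : ∀ X Y Z S T V : Matrix ι ι ℝ, S + T + V = 0 →
      X - S + (Y - T) + (Z - V) = X + Y + Z := by
    intro X Y Z S T V h
    rw [← sub_zero (X + Y + Z), ← h]; abel
  unfold covCurv
  rw [hmain _ _ _ _ _ _ hsum, hd, hd, hd]
  simp only [curvMatrix_eq]
  rw [matDeriv_comm hU (hA m) hy i l, matDeriv_comm hU (hA l) hy i m,
    matDeriv_comm hU (hA i) hy l m]
  noncomm_ring

/-- Lowering an index commutes with covariant differentiation of the curvature. -/
theorem covDeriv₄_riemann (hG : IsMetricOn G U) (hy : y ∈ U) (i j k l m : ι) :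
    covDeriv₄ G (riemann G) i j k l m y = (G y * covCurv G i l m y) j k := by
  have h1 : partialDeriv i (riemann G j k l m) y
      = (((connMatrix G i y)ᵀ * G y + G y * connMatrix G i y) * curvMatrix G l m y
        + G y * matDeriv i (curvMatrix G l m) y) j k := by
    rw [← hG.matDeriv_metric hy i, ← matDeriv_mul hG.isOpen hG.smooth (hG.smooth_curvMatrix l m) hy]
    exact partialDeriv_congr hG.isOpen hy (fun z _ => riemann_eq_mul G j k l m z) i
  have h2 : ∑ p, christoffel G p i j y * riemann G p k l m y
      = ((connMatrix G i y)ᵀ * (G y * curvMatrix G l m y)) j k := by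
    rw [Matrix.mul_apply]
    exact Finset.sum_congr rfl fun p _ => by rw [riemann_eq_mul]; rfl
  have h3 : ∑ p, christoffel G p i k y * riemann G j p l m y
      = ((G y * curvMatrix G l m y) * connMatrix G i y) j k := by
    rw [Matrix.mul_apply]
    exact Finset.sum_congr rfl fun p _ => by rw [riemann_eq_mul, mul_comm]; rfl
  have h4 : ∑ p, christoffel G p i l y * riemann G j k p m y
      = (G y * ∑ p, christoffel G p i l y • curvMatrix G p m y) j k := by
    rw [Matrix.mul_sum, Matrix.sum_apply]
    exact Finset.sum_congr rfl fun p _ => by rw [riemann_eq_mul, Matrix.mul_smul]; rfl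
  have h5 : ∑ p, christoffel G p i m y * riemann G j k l p y
      = (G y * ∑ p, christoffel G p i m y • curvMatrix G l p y) j k := by
    rw [Matrix.mul_sum, Matrix.sum_apply]
    exact Finset.sum_congr rfl fun p _ => by rw [riemann_eq_mul, Matrix.mul_smul]; rfl
  unfold covDeriv₄ covCurv
  simp only [Finset.sum_add_distrib]
  rw [h1, h2, h3, h4, h5]
  have e : ∀ B D A K S T : Matrix ι ι ℝ,
      G y * (D + (A * K - K * A) - (S + T))
        = (B * G y + G y * A) * K + G y * D - (B * (G y * K) + G y * K * A + G y * S + G y * T) := by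
    intros
    noncomm_ring
  rw [e (connMatrix G i y)ᵀ]
  rfl

end IsMetricOn

end CoordMetric

/-! ### The contracted Bianchi identity and Einstein metrics -/

namespace CoordMetric

open scoped Topology
open Finset Matrix

variable {ι : Type*} [Fintype ι] [DecidableEq ι]
variable {U : Set (ι → ℝ)} {f g : (ι → ℝ) → ℝ} {y : ι → ℝ}

/-- The covariant derivative `∇_i R_{km}` of the Ricci tensor. -/
noncomputable def covRicci (G : (ι → ℝ) → Matrix ι ι ℝ) (i k m : ι) (y : ι → ℝ) : ℝ :=
  partialDeriv i (ricci G k m) y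
    - ∑ q, (christoffel G q i k y * ricci G q m y + christoffel G q i m y * ricci G k q y)

/-- The trace-adjusted curvature
`W_{jklm} = R_{jklm} - (g ∧ Ric)_{jklm} / (d - 1) + R (g_{jl} g_{km} - g_{jm} g_{kl}) / (d (d - 1))`
of a metric in dimension `d`. The coefficients are those of the Weyl tensor in dimension `d + 1`:
this is the spatial part of the Weyl tensor of a warped product with one more dimension. -/
noncomputable def spatialWeyl (G : (ι → ℝ) → Matrix ι ι ℝ) (j k l m : ι) (y : ι → ℝ) : ℝ :=
  riemann G j k l m y
    - (1 / ((Fintype.card ι : ℝ) - 1)) *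
        (G y j l * ricci G k m y - G y j m * ricci G k l y
          + G y k m * ricci G j l y - G y k l * ricci G j m y)
    + (scalarCurv G y / ((Fintype.card ι : ℝ) * ((Fintype.card ι : ℝ) - 1))) *
        (G y j l * G y k m - G y j m * G y k l)

theorem covCurv_swap (G : (ι → ℝ) → Matrix ι ι ℝ) (i l m : ι) (y : ι → ℝ) :
    covCurv G i m l y = -covCurv G i l m y := by
  have h1 : matDeriv i (curvMatrix G m l) y = -matDeriv i (curvMatrix G l m) y := by
    ext p k
    simp only [matDeriv, curvMatrix, Matrix.of_apply, Matrix.neg_apply]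
    rw [← partialDeriv_neg]
    congr 1
    exact funext fun z => riemannMixed_swap G p k l m z
  have h2 : (∑ q, (christoffel G q i m y • curvMatrix G q l y
        + christoffel G q i l y • curvMatrix G m q y))
      = -∑ q, (christoffel G q i l y • curvMatrix G q m y
        + christoffel G q i m y • curvMatrix G l q y) := by
    rw [← Finset.sum_neg_distrib]
    refine Finset.sum_congr rfl fun q _ => ?_
    rw [curvMatrix_swap G l q, curvMatrix_swap G q m]
    simp only [smul_neg]
    abel
  unfold covCurv
  rw [h1, h2, curvMatrix_swap G l m]
  noncomm_ring

/-- Contraction of the curvature commutes with covariant differentiation: the two Christoffel terms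
that involve the contracted pair cancel. -/
theorem sum_covCurv (G : (ι → ℝ) → Matrix ι ι ℝ) (hd : ∀ p k l m,
    DifferentiableAt ℝ (riemannMixed G p k l m) y) (i k m : ι) :
    ∑ p, covCurv G i p m y p k = covRicci G i k m y := by
  have h1 : partialDeriv i (ricci G k m) y = ∑ p, partialDeriv i (riemannMixed G p k p m) y :=
    partialDeriv_sum (f := fun p => riemannMixed G p k p m) (fun p _ => hd p k p m) i
  have e : ∀ p, covCurv G i p m y p k = partialDeriv i (riemannMixed G p k p m) y
      + (∑ q, christoffel G p i q y * riemannMixed G q k p m y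
        - ∑ q, riemannMixed G p q p m y * christoffel G q i k y)
      - (∑ q, christoffel G q i p y * riemannMixed G p k q m y
        + ∑ q, christoffel G q i m y * riemannMixed G p k p q y) := by
    intro p
    simp only [covCurv, Matrix.add_apply, Matrix.sub_apply, Matrix.mul_apply, Matrix.sum_apply,
      Matrix.smul_apply, smul_eq_mul, matDeriv, curvMatrix, connMatrix, Matrix.of_apply,
      Finset.sum_add_distrib]
  have c1 : ∑ p, ∑ q, christoffel G p i q y * riemannMixed G q k p m y
      = ∑ p, ∑ q, christoffel G q i p y * riemannMixed G p k q m y := Finset.sum_comm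
  have c2 : ∑ p, ∑ q, riemannMixed G p q p m y * christoffel G q i k y
      = ∑ q, christoffel G q i k y * ricci G q m y := by
    rw [Finset.sum_comm]
    refine Finset.sum_congr rfl fun q _ => ?_
    rw [ricci, Finset.mul_sum]
    exact Finset.sum_congr rfl fun p _ => mul_comm _ _
  have c3 : ∑ p, ∑ q, christoffel G q i m y * riemannMixed G p k p q y
      = ∑ q, christoffel G q i m y * ricci G k q y := by
    rw [Finset.sum_comm]
    refine Finset.sum_congr rfl fun q _ => ?_
    rw [ricci, Finset.mul_sum]
  rw [Finset.sum_congr rfl fun p _ => e p]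
  simp only [covRicci, Finset.sum_sub_distrib, Finset.sum_add_distrib]
  rw [h1, c1, c2, c3]
  ring

theorem covDeriv₄_congr (hU : IsOpen U) (hy : y ∈ U) {G : (ι → ℝ) → Matrix ι ι ℝ}
    {S T : ι → ι → ι → ι → (ι → ℝ) → ℝ} (h : ∀ j k l m, Set.EqOn (S j k l m) (T j k l m) U)
    (i j k l m : ι) : covDeriv₄ G S i j k l m y = covDeriv₄ G T i j k l m y := by
  unfold covDeriv₄
  rw [partialDeriv_congr hU hy (h j k l m)]
  congr 1
  refine Finset.sum_congr rfl fun p _ => ?_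
  rw [h _ _ _ _ hy, h _ _ _ _ hy, h _ _ _ _ hy, h _ _ _ _ hy]

theorem covDeriv₄_sub {G : (ι → ℝ) → Matrix ι ι ℝ}
    {S T : ι → ι → ι → ι → (ι → ℝ) → ℝ} (hS : ∀ j k l m, DifferentiableAt ℝ (S j k l m) y)
    (hT : ∀ j k l m, DifferentiableAt ℝ (T j k l m) y) (i j k l m : ι) :
    covDeriv₄ G (fun j k l m z => S j k l m z - T j k l m z) i j k l m y
      = covDeriv₄ G S i j k l m y - covDeriv₄ G T i j k l m y := by
  unfold covDeriv₄
  rw [partialDeriv_sub (hS j k l m) (hT j k l m), sub_sub_sub_comm, ← Finset.sum_sub_distrib]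
  congr 1
  exact Finset.sum_congr rfl fun p _ => by ring

namespace IsMetricOn

variable {G : (ι → ℝ) → Matrix ι ι ℝ}

theorem covDeriv₄_riemann_swap_left (hG : IsMetricOn G U) (hy : y ∈ U) (i j k l m : ι) :
    covDeriv₄ G (riemann G) i k j l m y = -covDeriv₄ G (riemann G) i j k l m y := by
  unfold covDeriv₄
  rw [partialDeriv_congr hG.isOpen hy (fun z hz => hG.riemann_swap_left hz j k l m),
    partialDeriv_neg, neg_sub', ← Finset.sum_neg_distrib]
  congr 1
  refine Finset.sum_congr rfl fun p _ => ?_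
  rw [hG.riemann_swap_left hy j p l m, hG.riemann_swap_left hy p k l m,
    hG.riemann_swap_left hy j k p m, hG.riemann_swap_left hy j k l p]
  ring

theorem covDeriv₄_riemann_pair_symm (hG : IsMetricOn G U) (hy : y ∈ U) (i j k l m : ι) :
    covDeriv₄ G (riemann G) i j k l m y = covDeriv₄ G (riemann G) i l m j k y := by
  unfold covDeriv₄
  rw [partialDeriv_congr hG.isOpen hy (fun z hz => hG.riemann_pair_symm hz j k l m)]
  congr 1
  refine Finset.sum_congr rfl fun p _ => ?_
  rw [hG.riemann_pair_symm hy p k l m, hG.riemann_pair_symm hy j p l m,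
    hG.riemann_pair_symm hy j k p m, hG.riemann_pair_symm hy j k l p]
  ring

theorem sum_covCurv (hG : IsMetricOn G U) (hy : y ∈ U) (i k m : ι) :
    ∑ p, covCurv G i p m y p k = covRicci G i k m y :=
  CoordMetric.sum_covCurv G (fun p k l m =>
    differentiableAt_of_contDiffOn hG.isOpen (hG.smooth_riemannMixed p k l m) hy) i k m

theorem sum_inv_mul_metric_mul (hG : IsMetricOn G U) (hy : y ∈ U) (X : Matrix ι ι ℝ) (l k : ι) :
    ∑ j, (G y)⁻¹ l j * (G y * X) j k = X l k := by
  rw [← Matrix.mul_apply, ← Matrix.mul_assoc, hG.inv_mul_cancel hy, Matrix.one_mul]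

/-- `g^{lj} ∇_i R_{jklm} = ∇_i R_{km}`. -/
theorem sum_inv_mul_covDeriv₄_riemann (hG : IsMetricOn G U) (hy : y ∈ U) (i k m : ι) :
    ∑ l, ∑ j, (G y)⁻¹ l j * covDeriv₄ G (riemann G) i j k l m y = covRicci G i k m y := by
  rw [← hG.sum_covCurv hy]
  refine Finset.sum_congr rfl fun l _ => ?_
  simp only [hG.covDeriv₄_riemann hy]
  exact hG.sum_inv_mul_metric_mul hy _ l k

/-- The contracted Bianchi identity `∇^m R_{jklm} = ∇_k R_{lj} - ∇_j R_{lk}`. -/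
theorem div_riemann (hG : IsMetricOn G U) (hy : y ∈ U) (j k l : ι) :
    ∑ m, ∑ i, (G y)⁻¹ m i * covDeriv₄ G (riemann G) i j k l m y
      = covRicci G k l j y - covRicci G j l k y := by
  have h : ∀ i m, covDeriv₄ G (riemann G) i j k l m y
      = (G y * covCurv G k i j y) m l - (G y * covCurv G j i k y) m l := by
    intro i m
    rw [hG.covDeriv₄_riemann_pair_symm hy, hG.covDeriv₄_riemann_swap_left hy,
      hG.covDeriv₄_riemann hy, ← Matrix.sub_apply, ← Matrix.neg_apply]
    have hb := hG.covCurv_cyclic hy i j k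
    have hs := covCurv_swap G j i k y
    have e : covCurv G i j k y = covCurv G j i k y - covCurv G k i j y := by
      rw [hs] at hb
      rw [← sub_eq_zero, ← hb]
      abel
    have e2 : G y * covCurv G k i j y - G y * covCurv G j i k y = -(G y * covCurv G i j k y) := by
      rw [e]
      noncomm_ring
    rw [e2]
  simp only [h, mul_sub, Finset.sum_sub_distrib]
  rw [← hG.sum_covCurv hy, ← hG.sum_covCurv hy]
  have c : ∀ (X : ι → Matrix ι ι ℝ), ∑ m, ∑ i, (G y)⁻¹ m i * (G y * X i) m l = ∑ i, X i i l := by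
    intro X
    rw [Finset.sum_comm]
    refine Finset.sum_congr rfl fun i _ => ?_
    simp only [hG.inv_apply_comm hy _ i]
    exact hG.sum_inv_mul_metric_mul hy _ i l
  rw [c, c]

theorem covRicci_of_einstein (hG : IsMetricOn G U) (hf : ContDiffOn ℝ ∞ f U)
    (hE : ∀ z ∈ U, ∀ k m, ricci G k m z = f z * G z k m) (hy : y ∈ U) (i k m : ι) :
    covRicci G i k m y = partialDeriv i f y * G y k m := by
  unfold covRicci
  rw [partialDeriv_congr hG.isOpen hy (fun z hz => hE z hz k m),
    partialDeriv_mul (differentiableAt_of_contDiffOn hG.isOpen hf hy)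
      (hG.smooth.differentiableAt hG.isOpen hy k m), hG.partialDeriv_metric hy, Finset.mul_sum,
    add_sub_assoc, ← Finset.sum_sub_distrib, Finset.sum_eq_zero, add_zero]
  intro q _
  rw [hE y hy, hE y hy]
  ring

/-- Schur's lemma: in dimension at least three the Einstein factor is locally constant. -/
theorem partialDeriv_einstein_factor (hG : IsMetricOn G U) (hcard : 2 < Fintype.card ι)
    (hf : ContDiffOn ℝ ∞ f U)
    (hE : ∀ z ∈ U, ∀ k m, ricci G k m z = f z * G z k m) (hy : y ∈ U) (j : ι) :
    partialDeriv j f y = 0 := by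
  have hR := fun i k m => hG.covRicci_of_einstein hf hE hy i k m
  -- Both sides of the contracted Bianchi identity are contracted once more, over `k` and `l`.
  have h1 : ∑ l, ∑ k, (G y)⁻¹ l k *
      ∑ m, ∑ i, (G y)⁻¹ m i * covDeriv₄ G (riemann G) i j k l m y = -partialDeriv j f y := by
    have e : ∀ l k, (G y)⁻¹ l k * ∑ m, ∑ i, (G y)⁻¹ m i * covDeriv₄ G (riemann G) i j k l m y
        = ∑ m, ∑ i, -((G y)⁻¹ m i * ((G y)⁻¹ l k * covDeriv₄ G (riemann G) i k j l m y)) := by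
      intro l k
      rw [Finset.mul_sum]
      refine Finset.sum_congr rfl fun m _ => ?_
      rw [Finset.mul_sum]
      refine Finset.sum_congr rfl fun i _ => ?_
      rw [hG.covDeriv₄_riemann_swap_left hy i k j]
      ring
    simp only [e]
    have e2 : ∀ F : ι → ι → ι → ι → ℝ,
        ∑ l, ∑ k, ∑ m, ∑ i, F l k m i = ∑ m, ∑ i, ∑ l, ∑ k, F l k m i := by
      intro F
      have := Finset.sum_comm (s := (Finset.univ : Finset (ι × ι)))
        (t := (Finset.univ : Finset (ι × ι))) (f := fun p q => F p.1 p.2 q.1 q.2)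
      simpa only [Fintype.sum_prod_type] using this
    rw [e2]
    have e3 : ∀ m i, ∑ l, ∑ k,
          -((G y)⁻¹ m i * ((G y)⁻¹ l k * covDeriv₄ G (riemann G) i k j l m y))
        = -(partialDeriv i f y * ((G y)⁻¹ i m * G y m j)) := by
      intro m i
      simp only [Finset.sum_neg_distrib, ← Finset.mul_sum]
      rw [hG.sum_inv_mul_covDeriv₄_riemann hy, hR, hG.apply_comm hy j m, hG.inv_apply_comm hy m i]
      ring
    rw [Finset.sum_congr rfl fun m _ => Finset.sum_congr rfl fun i _ => e3 m i, Finset.sum_comm]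
    simp only [Finset.sum_neg_distrib, ← Finset.mul_sum, hG.sum_inv_mul hy]
    simp
  have h2 : ∑ l, ∑ k, (G y)⁻¹ l k *
      ∑ m, ∑ i, (G y)⁻¹ m i * covDeriv₄ G (riemann G) i j k l m y
      = partialDeriv j f y - Fintype.card ι * partialDeriv j f y := by
    simp only [hG.div_riemann hy, hR, mul_sub, Finset.sum_sub_distrib]
    congr 1
    · rw [Finset.sum_comm]
      have e : ∀ l k, (G y)⁻¹ l k * (partialDeriv k f y * G y l j)
          = partialDeriv k f y * ((G y)⁻¹ k l * G y l j) := by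
        intro l k
        rw [hG.inv_apply_comm hy l k]
        ring
      simp only [e, ← Finset.mul_sum, hG.sum_inv_mul hy]
      simp
    · have e : ∀ l k, (G y)⁻¹ l k * (partialDeriv j f y * G y l k)
          = partialDeriv j f y * ((G y)⁻¹ l k * G y k l) := by
        intro l k
        rw [hG.apply_comm hy l k]
        ring
      simp only [e, ← Finset.mul_sum, hG.sum_inv_mul hy]
      simp [mul_comm]
  have h3 : ((Fintype.card ι : ℝ) - 2) * partialDeriv j f y = 0 := by linarith
  have h4 : (2 : ℝ) < Fintype.card ι := by exact_mod_cast hcard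
  exact (mul_eq_zero.mp h3).resolve_left (by linarith)

/-- Metric compatibility: `∇_i (c (g_{jl} g_{km} - g_{jm} g_{kl})) = ∂_i c (...)`. -/
theorem covDeriv₄_mul_metric_metric (hG : IsMetricOn G U) (hy : y ∈ U)
    (hf : DifferentiableAt ℝ f y) (i j k l m : ι) :
    covDeriv₄ G (fun j k l m z => f z * (G z j l * G z k m - G z j m * G z k l)) i j k l m y
      = partialDeriv i f y * (G y j l * G y k m - G y j m * G y k l) := by
  have hd := hG.smooth.differentiableAt hG.isOpen hy
  unfold covDeriv₄
  rw [partialDeriv_mul hf (((hd j l).fun_mul (hd k m)).fun_sub ((hd j m).fun_mul (hd k l))),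
    partialDeriv_sub ((hd j l).fun_mul (hd k m)) ((hd j m).fun_mul (hd k l)),
    partialDeriv_mul (hd j l) (hd k m), partialDeriv_mul (hd j m) (hd k l),
    hG.partialDeriv_metric hy, hG.partialDeriv_metric hy, hG.partialDeriv_metric hy,
    hG.partialDeriv_metric hy]
  simp only [Finset.mul_sum, Finset.sum_mul, ← Finset.sum_add_distrib, ← Finset.sum_sub_distrib]
  rw [add_sub_assoc, ← Finset.sum_sub_distrib, Finset.sum_eq_zero, add_zero]
  intro p _
  ring

/-- For an Einstein metric in dimension at least three the tensor `W` is divergence free. -/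
theorem div_spatialWeyl (hG : IsMetricOn G U) (hcard : 2 < Fintype.card ι)
    (hE : ∀ z ∈ U, ∀ k m, ricci G k m z = scalarCurv G z / Fintype.card ι * G z k m)
    (hy : y ∈ U) (j k l : ι) :
    ∑ m, ∑ i, (G y)⁻¹ m i * covDeriv₄ G (spatialWeyl G) i j k l m y = 0 := by
  have hU := hG.isOpen
  have h4 : (2 : ℝ) < Fintype.card ι := by exact_mod_cast hcard
  have hf : ContDiffOn ℝ ∞ (fun z => scalarCurv G z / Fintype.card ι) U :=
    hG.smooth_scalarCurv.div_const _
  have hf0 := fun i => hG.partialDeriv_einstein_factor hcard hf hE hy i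
  have hg : ContDiffOn ℝ ∞
      (fun z => (1 / ((Fintype.card ι : ℝ) - 1)) * (scalarCurv G z / Fintype.card ι)) U :=
    contDiffOn_const.mul hf
  have hg0 : ∀ i, partialDeriv i
      (fun z => (1 / ((Fintype.card ι : ℝ) - 1)) * (scalarCurv G z / Fintype.card ι)) y = 0 := by
    intro i
    rw [partialDeriv_mul (differentiableAt_const _) (differentiableAt_of_contDiffOn hU hf hy), hf0]
    simp
  have hW : ∀ j k l m, Set.EqOn (spatialWeyl G j k l m)
      (fun z => riemann G j k l m z
        - (1 / ((Fintype.card ι : ℝ) - 1)) * (scalarCurv G z / Fintype.card ι)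
          * (G z j l * G z k m - G z j m * G z k l)) U := by
    intro j k l m z hz
    simp only [spatialWeyl, hE z hz]
    have h5 : (Fintype.card ι : ℝ) ≠ 0 := by linarith
    have h6 : (Fintype.card ι : ℝ) - 1 ≠ 0 := by linarith
    field_simp
    ring
  have hc : ∀ i m, covDeriv₄ G (spatialWeyl G) i j k l m y
      = covDeriv₄ G (riemann G) i j k l m y := by
    intro i m
    have hd := hG.smooth.differentiableAt hU hy
    have hgd := differentiableAt_of_contDiffOn hU hg hy
    rw [covDeriv₄_congr hU hy hW, covDeriv₄_sub
      (fun j k l m => differentiableAt_of_contDiffOn hU (hG.smooth_riemann j k l m) hy)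
      (fun j k l m => hgd.fun_mul
        (((hd j l).fun_mul (hd k m)).fun_sub ((hd j m).fun_mul (hd k l)))),
      hG.covDeriv₄_mul_metric_metric hy hgd, hg0, zero_mul, sub_zero]
  simp only [hc, hG.div_riemann hy, hG.covRicci_of_einstein hf hE hy, hf0, zero_mul, sub_zero]

end IsMetricOn

end CoordMetric

/-! ### The curvature of a warped product `-dt² + a(t)² h` -/

namespace CoordMetric

open scoped Topology
open Finset Matrix

/-- The components of the warped product metric `-dt² + a(t)² h(x)` at `y = (t, x)`. -/
noncomputable def warpedMetric {d : ℕ} (a : ℝ → ℝ) (h : (Fin d → ℝ) → Matrix (Fin d) (Fin d) ℝ)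
    (y : Fin (d + 1) → ℝ) : Matrix (Fin (d + 1)) (Fin (d + 1)) ℝ :=
  Matrix.of fun i j =>
    (Fin.cases (Fin.cases (-1) (fun _ => 0) j)
      (fun μ => Fin.cases 0 (fun ν => a (y 0) ^ 2 * h (Fin.tail y) μ ν) j) i : ℝ)

/-- The product of an interval of times and a domain of spatial coordinates. -/
def warpedDomain {d : ℕ} (I : Set ℝ) (V : Set (Fin d → ℝ)) : Set (Fin (d + 1) → ℝ) :=
  {y | y 0 ∈ I ∧ Fin.tail y ∈ V}

/-- A smooth positive scale function on an open set of times, together with a smooth spatial metric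
on a coordinate domain. -/
structure IsWarpedOn {d : ℕ} (a : ℝ → ℝ) (I : Set ℝ) (h : (Fin d → ℝ) → Matrix (Fin d) (Fin d) ℝ)
    (V : Set (Fin d → ℝ)) : Prop where
  isOpen_time : IsOpen I
  smooth_scale : ContDiffOn ℝ ∞ a I
  scale_pos : ∀ t ∈ I, 0 < a t
  metric : IsMetricOn h V

variable {d : ℕ} {a : ℝ → ℝ} {I : Set ℝ} {h : (Fin d → ℝ) → Matrix (Fin d) (Fin d) ℝ}
  {V : Set (Fin d → ℝ)} {y : Fin (d + 1) → ℝ}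

theorem hasFDerivAt_tail (y : Fin (d + 1) → ℝ) :
    HasFDerivAt (fun z : Fin (d + 1) → ℝ => Fin.tail z)
      (ContinuousLinearMap.pi fun μ : Fin d =>
        ContinuousLinearMap.proj (R := ℝ) (φ := fun _ : Fin (d + 1) => ℝ) μ.succ) y :=
  (ContinuousLinearMap.pi fun μ : Fin d =>
    ContinuousLinearMap.proj (R := ℝ) (φ := fun _ : Fin (d + 1) => ℝ) μ.succ).hasFDerivAt

theorem hasFDerivAt_separated {c : ℝ → ℝ} {f : (Fin d → ℝ) → ℝ}
    (hc : DifferentiableAt ℝ c (y 0)) (hf : DifferentiableAt ℝ f (Fin.tail y)) :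
    HasFDerivAt (fun z : Fin (d + 1) → ℝ => c (z 0) * f (Fin.tail z))
      (c (y 0) • ((fderiv ℝ f (Fin.tail y)).comp (ContinuousLinearMap.pi fun μ : Fin d =>
        ContinuousLinearMap.proj (R := ℝ) (φ := fun _ : Fin (d + 1) => ℝ) μ.succ))
      + f (Fin.tail y) • (deriv c (y 0) •
        ContinuousLinearMap.proj (R := ℝ) (φ := fun _ : Fin (d + 1) => ℝ) 0)) y := by
  have h0 : HasFDerivAt (fun z : Fin (d + 1) → ℝ => z 0)
      (ContinuousLinearMap.proj (R := ℝ) (φ := fun _ : Fin (d + 1) => ℝ) 0) y :=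
    (ContinuousLinearMap.proj (R := ℝ) (φ := fun _ : Fin (d + 1) => ℝ) 0).hasFDerivAt
  have h1 := hc.hasDerivAt.comp_hasFDerivAt y h0
  have h2 : HasFDerivAt (fun z : Fin (d + 1) → ℝ => f (Fin.tail z)) _ y :=
    HasFDerivAt.comp y hf.hasFDerivAt (hasFDerivAt_tail y)
  exact h1.mul h2

theorem partialDeriv_zero_separated {c : ℝ → ℝ} {f : (Fin d → ℝ) → ℝ}
    (hc : DifferentiableAt ℝ c (y 0)) (hf : DifferentiableAt ℝ f (Fin.tail y)) :
    partialDeriv 0 (fun z : Fin (d + 1) → ℝ => c (z 0) * f (Fin.tail z)) y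
      = deriv c (y 0) * f (Fin.tail y) := by
  have h0 : (fun μ : Fin d => (Pi.single 0 1 : Fin (d + 1) → ℝ) μ.succ) = 0 := by
    funext μ
    simp
  unfold partialDeriv
  rw [(hasFDerivAt_separated hc hf).fderiv]
  have : (ContinuousLinearMap.pi fun μ : Fin d =>
    ContinuousLinearMap.proj (R := ℝ) (φ := fun _ : Fin (d + 1) => ℝ) μ.succ) (Pi.single 0 1)
      = 0 := h0
  simp [this, mul_comm]

theorem partialDeriv_succ_separated {c : ℝ → ℝ} {f : (Fin d → ℝ) → ℝ}
    (hc : DifferentiableAt ℝ c (y 0)) (hf : DifferentiableAt ℝ f (Fin.tail y)) (μ : Fin d) :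
    partialDeriv μ.succ (fun z : Fin (d + 1) → ℝ => c (z 0) * f (Fin.tail z)) y
      = c (y 0) * partialDeriv μ f (Fin.tail y) := by
  have h0 : (ContinuousLinearMap.pi fun μ : Fin d =>
    ContinuousLinearMap.proj (R := ℝ) (φ := fun _ : Fin (d + 1) => ℝ) μ.succ)
      (Pi.single μ.succ 1) = Pi.single μ 1 := by
    funext ν
    simp [Pi.single_apply, Fin.succ_inj]
  unfold partialDeriv
  rw [(hasFDerivAt_separated hc hf).fderiv]
  simp [h0]

section Entries

@[simp] theorem warpedMetric_zero_zero : warpedMetric a h y 0 0 = -1 := rfl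

@[simp] theorem warpedMetric_zero_succ (μ : Fin d) : warpedMetric a h y 0 μ.succ = 0 := rfl

@[simp] theorem warpedMetric_succ_zero (μ : Fin d) : warpedMetric a h y μ.succ 0 = 0 := rfl

@[simp] theorem warpedMetric_succ_succ (μ ν : Fin d) :
    warpedMetric a h y μ.succ ν.succ = a (y 0) ^ 2 * h (Fin.tail y) μ ν := rfl

end Entries

namespace IsWarpedOn

variable (hw : IsWarpedOn a I h V) (hy : y ∈ warpedDomain I V)

include hw

theorem isOpen_warpedDomain : IsOpen (warpedDomain I V) :=
  (hw.isOpen_time.preimage (continuous_apply 0)).inter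
    (hw.metric.isOpen.preimage (continuous_pi fun μ : Fin d => continuous_apply μ.succ))

theorem contDiffOn_deriv : ContDiffOn ℝ ∞ (deriv a) I :=
  hw.smooth_scale.deriv_of_isOpen hw.isOpen_time (by simp)

include hy

theorem scale_ne_zero : a (y 0) ≠ 0 := (hw.scale_pos _ hy.1).ne'

theorem hasDerivAt_scale : HasDerivAt a (deriv a (y 0)) (y 0) :=
  ((hw.smooth_scale.contDiffAt (hw.isOpen_time.mem_nhds hy.1)).differentiableAt
    (by simp)).hasDerivAt

theorem hasDerivAt_deriv_scale : HasDerivAt (deriv a) (deriv (deriv a) (y 0)) (y 0) :=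
  ((hw.contDiffOn_deriv.contDiffAt (hw.isOpen_time.mem_nhds hy.1)).differentiableAt
    (by simp)).hasDerivAt

theorem inv_warpedMetric : (warpedMetric a h y)⁻¹ = Matrix.of fun i j =>
    (Fin.cases (Fin.cases (-1) (fun _ => 0) j)
      (fun μ => Fin.cases 0 (fun ν => (a (y 0) ^ 2)⁻¹ * (h (Fin.tail y))⁻¹ μ ν) j) i : ℝ) := by
  have ha := hw.scale_ne_zero hy
  refine Matrix.inv_eq_right_inv ?_
  ext i j
  rw [Matrix.mul_apply, Fin.sum_univ_succ, Matrix.one_apply]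
  refine Fin.cases ?_ (fun μ => ?_) i <;> refine Fin.cases ?_ (fun ν => ?_) j
  · simp
  · simp [Fin.ext_iff]
  · simp
  · have e := hw.metric.sum_mul_inv hy.2 μ ν
    simp only [warpedMetric_succ_zero, warpedMetric_succ_succ, Matrix.of_apply, Fin.cases_succ,
      zero_mul, zero_add, Fin.succ_inj]
    rw [← e]
    refine Finset.sum_congr rfl fun l _ => ?_
    field_simp

theorem inv_zero_zero : (warpedMetric a h y)⁻¹ 0 0 = -1 := by
  rw [hw.inv_warpedMetric hy]; rfl

theorem inv_zero_succ (μ : Fin d) : (warpedMetric a h y)⁻¹ 0 μ.succ = 0 := by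
  rw [hw.inv_warpedMetric hy]; rfl

theorem inv_succ_zero (μ : Fin d) : (warpedMetric a h y)⁻¹ μ.succ 0 = 0 := by
  rw [hw.inv_warpedMetric hy]; rfl

theorem inv_succ_succ (μ ν : Fin d) : (warpedMetric a h y)⁻¹ μ.succ ν.succ
    = (a (y 0) ^ 2)⁻¹ * (h (Fin.tail y))⁻¹ μ ν := by
  rw [hw.inv_warpedMetric hy]; rfl

omit hy

/-- The warped product metric is a smooth nondegenerate metric. -/
theorem isMetricOn : IsMetricOn (warpedMetric a h) (warpedDomain I V) where
  isOpen := hw.isOpen_warpedDomain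
  smooth := by
    intro i j
    refine Fin.cases ?_ (fun μ => ?_) i <;> refine Fin.cases ?_ (fun ν => ?_) j
    · exact contDiffOn_const
    · exact contDiffOn_const
    · exact contDiffOn_const
    · simp only [warpedMetric_succ_succ]
      refine ContDiffOn.mul (ContDiffOn.pow ?_ 2) ?_
      · exact hw.smooth_scale.comp (contDiff_apply ℝ ℝ 0).contDiffOn fun z hz => hz.1
      · exact (hw.metric.smooth μ ν).comp
          (contDiff_pi.2 fun κ : Fin d => contDiff_apply ℝ ℝ κ.succ).contDiffOn fun z hz => hz.2
  symm := by
    intro z hz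
    ext i j
    rw [Matrix.transpose_apply]
    refine Fin.cases ?_ (fun μ => ?_) i <;> refine Fin.cases ?_ (fun ν => ?_) j
    · rfl
    · rfl
    · rfl
    · simp [hw.metric.apply_comm hz.2 μ ν]
  isUnit_det := by
    intro z hz
    have ha := hw.scale_ne_zero hz
    by_contra hc
    have h0 : (warpedMetric a h z)⁻¹ = 0 := by
      rw [Matrix.inv_def, Ring.inverse_non_unit _ hc, zero_smul]
    have h1 := hw.inv_zero_zero hz
    rw [h0] at h1
    simp at h1

include hy

theorem differentiableAt_metric (μ ν : Fin d) :
    DifferentiableAt ℝ (fun x => h x μ ν) (Fin.tail y) :=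
  hw.metric.smooth.differentiableAt hw.metric.isOpen hy.2 μ ν

theorem hasDerivAt_sq_scale :
    HasDerivAt (fun t => a t ^ 2) (2 * a (y 0) * deriv a (y 0)) (y 0) := by
  simpa using (hw.hasDerivAt_scale hy).fun_pow 2

theorem partialDeriv_zero_metric (μ ν : Fin d) :
    partialDeriv 0 (fun z => warpedMetric a h z μ.succ ν.succ) y
      = 2 * a (y 0) * deriv a (y 0) * h (Fin.tail y) μ ν := by
  have e := partialDeriv_zero_separated (hw.hasDerivAt_sq_scale hy).differentiableAt
    (hw.differentiableAt_metric hy μ ν)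
  rwa [(hw.hasDerivAt_sq_scale hy).deriv] at e

theorem partialDeriv_succ_metric (κ μ ν : Fin d) :
    partialDeriv κ.succ (fun z => warpedMetric a h z μ.succ ν.succ) y
      = a (y 0) ^ 2 * partialDeriv κ (fun x => h x μ ν) (Fin.tail y) :=
  partialDeriv_succ_separated (hw.hasDerivAt_sq_scale hy).differentiableAt
    (hw.differentiableAt_metric hy μ ν) κ

theorem christoffel_zero_zero (j : Fin (d + 1)) :
    christoffel (warpedMetric a h) 0 0 j y = 0 := by
  refine Fin.cases ?_ (fun ν => ?_) j <;>
    simp [christoffel, Fin.sum_univ_succ, hw.inv_zero_zero hy, hw.inv_zero_succ hy]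

theorem christoffel_zero_succ_zero (μ : Fin d) :
    christoffel (warpedMetric a h) 0 μ.succ 0 y = 0 := by
  rw [hw.isMetricOn.christoffel_comm hy, hw.christoffel_zero_zero hy]

theorem christoffel_zero_succ_succ (μ ν : Fin d) :
    christoffel (warpedMetric a h) 0 μ.succ ν.succ y
      = a (y 0) * deriv a (y 0) * h (Fin.tail y) μ ν := by
  simp only [christoffel, Fin.sum_univ_succ, hw.inv_zero_zero hy, hw.inv_zero_succ hy,
    hw.partialDeriv_zero_metric hy, warpedMetric_succ_zero, partialDeriv_const, zero_mul,
    Finset.sum_const_zero]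
  ring

theorem christoffel_succ_zero_zero (κ : Fin d) :
    christoffel (warpedMetric a h) κ.succ 0 0 y = 0 := by
  simp [christoffel, Fin.sum_univ_succ, hw.inv_succ_zero hy]

theorem christoffel_succ_zero_succ (κ ν : Fin d) :
    christoffel (warpedMetric a h) κ.succ 0 ν.succ y
      = deriv a (y 0) / a (y 0) * if κ = ν then 1 else 0 := by
  have ha := hw.scale_ne_zero hy
  simp only [christoffel, Fin.sum_univ_succ, hw.inv_succ_zero hy, hw.inv_succ_succ hy,
    hw.partialDeriv_zero_metric hy, warpedMetric_zero_succ, partialDeriv_const, zero_mul,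
    zero_add, add_zero, sub_zero]
  rw [← hw.metric.sum_inv_mul hy.2 κ ν, Finset.mul_sum, Finset.mul_sum]
  refine Finset.sum_congr rfl fun l _ => ?_
  rw [hw.metric.apply_comm hy.2 ν l]
  field_simp

theorem christoffel_succ_succ_zero (κ ν : Fin d) :
    christoffel (warpedMetric a h) κ.succ ν.succ 0 y
      = deriv a (y 0) / a (y 0) * if κ = ν then 1 else 0 := by
  rw [hw.isMetricOn.christoffel_comm hy, hw.christoffel_succ_zero_succ hy]

theorem christoffel_succ_succ_succ (κ μ ν : Fin d) :
    christoffel (warpedMetric a h) κ.succ μ.succ ν.succ y = christoffel h κ μ ν (Fin.tail y) := by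
  have ha := hw.scale_ne_zero hy
  simp only [christoffel, Fin.sum_univ_succ, hw.inv_succ_zero hy, hw.inv_succ_succ hy,
    hw.partialDeriv_succ_metric hy, zero_mul, zero_add]
  congr 1
  refine Finset.sum_congr rfl fun l _ => ?_
  field_simp

theorem partialDeriv_eq_zero {f : (Fin (d + 1) → ℝ) → ℝ}
    (hf : ∀ z ∈ warpedDomain I V, f z = 0) (i : Fin (d + 1)) : partialDeriv i f y = 0 := by
  rw [partialDeriv_congr hw.isOpen_warpedDomain hy (g := fun _ => 0) hf, partialDeriv_const]

theorem partialDeriv_zero_eq {f : (Fin (d + 1) → ℝ) → ℝ} {c : ℝ → ℝ} {g : (Fin d → ℝ) → ℝ}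
    (hf : ∀ z ∈ warpedDomain I V, f z = c (z 0) * g (Fin.tail z))
    (hc : DifferentiableAt ℝ c (y 0)) (hg : DifferentiableAt ℝ g (Fin.tail y)) :
    partialDeriv 0 f y = deriv c (y 0) * g (Fin.tail y) := by
  rw [partialDeriv_congr hw.isOpen_warpedDomain hy (g := fun z => c (z 0) * g (Fin.tail z)) hf,
    partialDeriv_zero_separated hc hg]

theorem partialDeriv_succ_eq {f : (Fin (d + 1) → ℝ) → ℝ} {c : ℝ → ℝ} {g : (Fin d → ℝ) → ℝ}
    (hf : ∀ z ∈ warpedDomain I V, f z = c (z 0) * g (Fin.tail z))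
    (hc : DifferentiableAt ℝ c (y 0)) (hg : DifferentiableAt ℝ g (Fin.tail y)) (μ : Fin d) :
    partialDeriv μ.succ f y = c (y 0) * partialDeriv μ g (Fin.tail y) := by
  rw [partialDeriv_congr hw.isOpen_warpedDomain hy (g := fun z => c (z 0) * g (Fin.tail z)) hf,
    partialDeriv_succ_separated hc hg]

theorem hasDerivAt_mul_deriv : HasDerivAt (fun t => a t * deriv a t)
    (deriv a (y 0) ^ 2 + a (y 0) * deriv (deriv a) (y 0)) (y 0) := by
  have := (hw.hasDerivAt_scale hy).mul (hw.hasDerivAt_deriv_scale hy)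
  rw [pow_two]
  exact this

theorem hasDerivAt_hubble : HasDerivAt (fun t => deriv a t / a t)
    (deriv (deriv a) (y 0) / a (y 0) - (deriv a (y 0) / a (y 0)) ^ 2) (y 0) := by
  have ha := hw.scale_ne_zero hy
  refine ((hw.hasDerivAt_deriv_scale hy).fun_div (hw.hasDerivAt_scale hy) ha).congr_deriv ?_
  field_simp

theorem differentiableAt_christoffel (κ μ ν : Fin d) :
    DifferentiableAt ℝ (christoffel h κ μ ν) (Fin.tail y) :=
  differentiableAt_of_contDiffOn hw.metric.isOpen (hw.metric.smooth_christoffel κ μ ν) hy.2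

/-! The components `R^p_{klm}` of the curvature of the warped product. -/

theorem riemannMixed_zero_zero (l m : Fin (d + 1)) :
    riemannMixed (warpedMetric a h) 0 0 l m y = 0 := by
  have hz : ∀ l : Fin (d + 1), ∀ z ∈ warpedDomain I V,
      christoffel (warpedMetric a h) 0 l 0 z = 0 := by
    intro l z hz
    rw [hw.isMetricOn.christoffel_comm hz, hw.christoffel_zero_zero hz]
  unfold riemannMixed
  rw [hw.partialDeriv_eq_zero hy (hz m), hw.partialDeriv_eq_zero hy (hz l), Fin.sum_univ_succ]
  refine Fin.cases ?_ (fun μ => ?_) l <;> refine Fin.cases ?_ (fun ν => ?_) m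
  · simp
  · simp [hw.christoffel_zero_zero hy, hw.christoffel_succ_zero_zero hy]
  · simp [hw.christoffel_zero_zero hy, hw.christoffel_succ_zero_zero hy]
  · simp [hw.christoffel_zero_succ_zero hy, hw.christoffel_succ_succ_zero hy,
      hw.christoffel_zero_succ_succ hy, hw.metric.apply_comm hy.2 μ ν]

theorem riemannMixed_zero_succ_zero_succ (μ ν : Fin d) :
    riemannMixed (warpedMetric a h) 0 μ.succ 0 ν.succ y
      = a (y 0) * deriv (deriv a) (y 0) * h (Fin.tail y) μ ν := by
  have ha := hw.scale_ne_zero hy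
  unfold riemannMixed
  rw [hw.partialDeriv_zero_eq hy (c := fun t => a t * deriv a t) (g := fun x => h x ν μ)
    (fun z hz => hw.christoffel_zero_succ_succ hz ν μ)
    (hw.hasDerivAt_mul_deriv hy).differentiableAt (hw.differentiableAt_metric hy ν μ),
    hw.partialDeriv_eq_zero hy (fun z hz => hw.christoffel_zero_zero hz _),
    (hw.hasDerivAt_mul_deriv hy).deriv, Fin.sum_univ_succ]
  simp [hw.christoffel_zero_zero hy, hw.christoffel_zero_succ_zero hy,
      hw.christoffel_succ_zero_succ hy, hw.christoffel_zero_succ_succ hy,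
      hw.metric.apply_comm hy.2 μ ν]
  field_simp
  ring

theorem riemannMixed_zero_succ_succ_succ (μ ν ρ : Fin d) :
    riemannMixed (warpedMetric a h) 0 μ.succ ν.succ ρ.succ y = 0 := by
  have e : ∀ μ ν ρ : Fin d, partialDeriv μ.succ
      (christoffel (warpedMetric a h) 0 ν.succ ρ.succ) y
        = a (y 0) * deriv a (y 0) * partialDeriv μ (fun x => h x ν ρ) (Fin.tail y) :=
    fun μ ν ρ => hw.partialDeriv_succ_eq hy (c := fun t => a t * deriv a t)
      (g := fun x => h x ν ρ) (fun z hz => hw.christoffel_zero_succ_succ hz ν ρ)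
      (hw.hasDerivAt_mul_deriv hy).differentiableAt (hw.differentiableAt_metric hy ν ρ) μ
  have s1 := hw.metric.sum_mul_christoffel hy.2 ν ρ μ
  have s2 := hw.metric.sum_mul_christoffel hy.2 ρ ν μ
  unfold riemannMixed
  rw [e, e, Fin.sum_univ_succ]
  simp only [hw.christoffel_zero_succ_zero hy, hw.christoffel_zero_succ_succ hy,
    hw.christoffel_succ_succ_succ hy, zero_mul, sub_zero, zero_add, Finset.sum_sub_distrib,
    mul_assoc, ← Finset.mul_sum]
  rw [s1, s2, hw.metric.partialDeriv_apply_comm hy.2 ν μ ρ,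
    hw.metric.partialDeriv_apply_comm hy.2 ρ μ ν, hw.metric.partialDeriv_apply_comm hy.2 μ ρ ν]
  ring

theorem riemannMixed_succ_zero_zero_succ (μ ν : Fin d) :
    riemannMixed (warpedMetric a h) μ.succ 0 0 ν.succ y
      = deriv (deriv a) (y 0) / a (y 0) * if μ = ν then 1 else 0 := by
  have ha := hw.scale_ne_zero hy
  unfold riemannMixed
  rw [hw.partialDeriv_zero_eq hy (c := fun t => deriv a t / a t)
      (g := fun _ => if μ = ν then 1 else 0)
      (fun z hz => hw.christoffel_succ_succ_zero hz μ ν)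
      (hw.hasDerivAt_hubble hy).differentiableAt (differentiableAt_const _),
    hw.partialDeriv_eq_zero hy (fun z hz => hw.christoffel_succ_zero_zero hz _),
    (hw.hasDerivAt_hubble hy).deriv, Fin.sum_univ_succ]
  simp only [hw.christoffel_succ_zero_zero hy, hw.christoffel_zero_succ_zero hy,
    hw.christoffel_zero_zero hy,
    hw.christoffel_succ_zero_succ hy, hw.christoffel_succ_succ_zero hy]
  by_cases hμ : μ = ν
  · simp [hμ]
    ring
  · simp [hμ]

theorem riemannMixed_succ_zero_succ_succ (μ ν ρ : Fin d) :
    riemannMixed (warpedMetric a h) μ.succ 0 ν.succ ρ.succ y = 0 := by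
  have e : ∀ μ ν ρ : Fin d, partialDeriv μ.succ
      (christoffel (warpedMetric a h) ν.succ ρ.succ 0) y = 0 := by
    intro μ ν ρ
    rw [hw.partialDeriv_succ_eq hy (c := fun t => deriv a t / a t)
      (g := fun _ => if ν = ρ then 1 else 0)
      (fun z hz => hw.christoffel_succ_succ_zero hz ν ρ)
      (hw.hasDerivAt_hubble hy).differentiableAt (differentiableAt_const _),
      partialDeriv_const, mul_zero]
  unfold riemannMixed
  rw [e, e, Fin.sum_univ_succ]
  simp [hw.christoffel_zero_succ_zero hy, hw.christoffel_succ_succ_zero hy,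
    hw.christoffel_succ_succ_succ hy, hw.metric.christoffel_comm hy.2 μ ν ρ]

theorem riemannMixed_succ_succ_zero_succ (μ ν ρ : Fin d) :
    riemannMixed (warpedMetric a h) μ.succ ν.succ 0 ρ.succ y = 0 := by
  unfold riemannMixed
  rw [hw.partialDeriv_succ_eq hy (c := fun t => deriv a t / a t)
      (g := fun _ => if μ = ν then 1 else 0)
      (fun z hz => hw.christoffel_succ_zero_succ hz μ ν)
      (hw.hasDerivAt_hubble hy).differentiableAt (differentiableAt_const _),
    hw.partialDeriv_zero_eq hy (c := fun _ => 1) (g := christoffel h μ ρ ν)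
      (fun z hz => by rw [hw.christoffel_succ_succ_succ hz, one_mul])
      (differentiableAt_const _) (hw.differentiableAt_christoffel hy μ ρ ν), Fin.sum_univ_succ]
  simp [hw.christoffel_succ_zero_zero hy, hw.christoffel_zero_zero hy,
    hw.christoffel_succ_zero_succ hy, hw.christoffel_succ_succ_succ hy, mul_comm]

theorem riemannMixed_succ_succ_succ_succ (κ μ ν ρ : Fin d) :
    riemannMixed (warpedMetric a h) κ.succ μ.succ ν.succ ρ.succ y
      = riemannMixed h κ μ ν ρ (Fin.tail y) + deriv a (y 0) ^ 2 *
        ((if κ = ν then 1 else 0) * h (Fin.tail y) ρ μ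
          - (if κ = ρ then 1 else 0) * h (Fin.tail y) ν μ) := by
  have ha := hw.scale_ne_zero hy
  have e : ∀ κ μ ν ρ : Fin d, partialDeriv κ.succ
      (christoffel (warpedMetric a h) μ.succ ν.succ ρ.succ) y
        = partialDeriv κ (christoffel h μ ν ρ) (Fin.tail y) := by
    intro κ μ ν ρ
    rw [hw.partialDeriv_succ_eq hy (c := fun _ => 1) (g := christoffel h μ ν ρ)
      (fun z hz => by rw [hw.christoffel_succ_succ_succ hz, one_mul])
      (differentiableAt_const _) (hw.differentiableAt_christoffel hy μ ν ρ), one_mul]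
  unfold riemannMixed
  rw [e, e, Fin.sum_univ_succ]
  simp only [hw.christoffel_succ_succ_zero hy, hw.christoffel_zero_succ_succ hy,
    hw.christoffel_succ_succ_succ hy]
  field_simp
  ring

theorem ricci_zero_zero : ricci (warpedMetric a h) 0 0 y
    = -(d * (deriv (deriv a) (y 0) / a (y 0))) := by
  rw [ricci, Fin.sum_univ_succ, hw.riemannMixed_zero_zero hy]
  simp [riemannMixed_swap _ _ (0 : Fin (d + 1)) 0 (Fin.succ _), hw.riemannMixed_succ_zero_zero_succ hy]

theorem ricci_zero_succ (μ : Fin d) : ricci (warpedMetric a h) 0 μ.succ y = 0 := by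
  rw [ricci, Fin.sum_univ_succ, hw.riemannMixed_zero_zero hy]
  simp [hw.riemannMixed_succ_zero_succ_succ hy]

theorem ricci_succ_zero (μ : Fin d) : ricci (warpedMetric a h) μ.succ 0 y = 0 := by
  have e : riemannMixed (warpedMetric a h) 0 μ.succ 0 0 y = 0 := by
    linarith [riemannMixed_swap (warpedMetric a h) 0 μ.succ 0 0 y]
  rw [ricci, Fin.sum_univ_succ, e]
  simp [riemannMixed_swap _ _ _ 0 (Fin.succ _), hw.riemannMixed_succ_succ_zero_succ hy]

theorem ricci_succ_succ (μ ν : Fin d) : ricci (warpedMetric a h) μ.succ ν.succ y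
    = ricci h μ ν (Fin.tail y) + (a (y 0) * deriv (deriv a) (y 0)
      + (d - 1) * deriv a (y 0) ^ 2) * h (Fin.tail y) μ ν := by
  rw [ricci, Fin.sum_univ_succ, hw.riemannMixed_zero_succ_zero_succ hy]
  simp only [hw.riemannMixed_succ_succ_succ_succ hy, Finset.sum_add_distrib, ← Finset.mul_sum,
    Finset.sum_sub_distrib]
  rw [hw.metric.apply_comm hy.2 μ ν, ricci]
  simp
  ring

theorem scalarCurv_eq : scalarCurv (warpedMetric a h) y
    = scalarCurv h (Fin.tail y) / a (y 0) ^ 2 + 2 * d * (deriv (deriv a) (y 0) / a (y 0))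
      + d * (d - 1) * (deriv a (y 0) / a (y 0)) ^ 2 := by
  have ha := hw.scale_ne_zero hy
  have tr : ∑ μ, ∑ ν, (h (Fin.tail y))⁻¹ μ ν * h (Fin.tail y) μ ν = d := by
    have e : ∀ μ, ∑ ν, (h (Fin.tail y))⁻¹ μ ν * h (Fin.tail y) μ ν = 1 := by
      intro μ
      simp only [hw.metric.apply_comm hy.2 μ]
      simpa using hw.metric.sum_inv_mul hy.2 μ μ
    simp [e]
  have e2 : ∀ μ ν : Fin d, (a (y 0) ^ 2)⁻¹ * (h (Fin.tail y))⁻¹ μ ν *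
      (ricci h μ ν (Fin.tail y) + (a (y 0) * deriv (deriv a) (y 0)
        + (d - 1) * deriv a (y 0) ^ 2) * h (Fin.tail y) μ ν)
      = (a (y 0) ^ 2)⁻¹ * ((h (Fin.tail y))⁻¹ μ ν * ricci h μ ν (Fin.tail y))
        + ((a (y 0) ^ 2)⁻¹ * (a (y 0) * deriv (deriv a) (y 0) + (d - 1) * deriv a (y 0) ^ 2))
          * ((h (Fin.tail y))⁻¹ μ ν * h (Fin.tail y) μ ν) := fun μ ν => by ring
  simp only [scalarCurv, Fin.sum_univ_succ, hw.inv_zero_zero hy, hw.inv_zero_succ hy,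
    hw.inv_succ_zero hy, hw.inv_succ_succ hy, hw.ricci_zero_zero hy, hw.ricci_succ_succ hy,
    zero_mul, Finset.sum_const_zero, add_zero, zero_add, e2, Finset.sum_add_distrib,
    ← Finset.mul_sum, tr]
  field_simp
  ring

end IsWarpedOn

end CoordMetric

/-! ### The Weyl tensor of a warped product and its divergence -/

namespace CoordMetric

open scoped Topology
open Finset Matrix

theorem weyl_swap_right {ι : Type*} [Fintype ι] [DecidableEq ι] (G : (ι → ℝ) → Matrix ι ι ℝ)
    (j k l m : ι) (y : ι → ℝ) : weyl G j k m l y = -weyl G j k l m y := by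
  unfold weyl
  rw [riemann_swap_right G j k l m]
  ring

theorem IsMetricOn.weyl_swap_left {ι : Type*} [Fintype ι] [DecidableEq ι]
    {G : (ι → ℝ) → Matrix ι ι ℝ} {U : Set (ι → ℝ)} {y : ι → ℝ} (hG : IsMetricOn G U) (hy : y ∈ U)
    (j k l m : ι) : weyl G k j l m y = -weyl G j k l m y := by
  unfold weyl
  rw [hG.riemann_swap_left hy j k l m]
  ring

theorem IsMetricOn.weylDiv_swap {ι : Type*} [Fintype ι] [DecidableEq ι]
    {G : (ι → ℝ) → Matrix ι ι ℝ} {U : Set (ι → ℝ)} {y : ι → ℝ} (hG : IsMetricOn G U) (hy : y ∈ U)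
    (j k l : ι) : weylDiv G k j l y = -weylDiv G j k l y := by
  have e : ∀ i m, covDeriv₄ G (weyl G) i k j l m y = -covDeriv₄ G (weyl G) i j k l m y := by
    intro i m
    unfold covDeriv₄
    rw [partialDeriv_congr hG.isOpen hy (fun z hz => hG.weyl_swap_left hz j k l m),
      partialDeriv_neg, neg_sub', ← Finset.sum_neg_distrib]
    congr 1
    refine Finset.sum_congr rfl fun p _ => ?_
    rw [hG.weyl_swap_left hy j p l m, hG.weyl_swap_left hy p k l m,
      hG.weyl_swap_left hy j k p m, hG.weyl_swap_left hy j k l p]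
    ring
  simp only [weylDiv, e, mul_neg, Finset.sum_neg_distrib]

/-- The trace-free part `(R_{km} - R g_{km} / d) / (d - 1)` of the Ricci tensor, normalized by
`d - 1`, in dimension `d`. -/
noncomputable def tracelessRicci {ι : Type*} [Fintype ι] [DecidableEq ι]
    (G : (ι → ℝ) → Matrix ι ι ℝ) (k m : ι) (y : ι → ℝ) : ℝ :=
  (1 / ((Fintype.card ι : ℝ) - 1)) *
    (ricci G k m y - scalarCurv G y / Fintype.card ι * G y k m)

namespace IsMetricOn

variable {ι : Type*} [Fintype ι] [DecidableEq ι] {G : (ι → ℝ) → Matrix ι ι ℝ}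
  {U : Set (ι → ℝ)} {y : ι → ℝ}

theorem smooth_tracelessRicci (hG : IsMetricOn G U) (k m : ι) :
    ContDiffOn ℝ ∞ (tracelessRicci G k m) U :=
  contDiffOn_const.mul ((hG.smooth_ricci k m).sub
    ((hG.smooth_scalarCurv.div_const _).mul (hG.smooth k m)))

theorem smooth_spatialWeyl (hG : IsMetricOn G U) (j k l m : ι) :
    ContDiffOn ℝ ∞ (spatialWeyl G j k l m) U := by
  refine ((hG.smooth_riemann j k l m).sub (contDiffOn_const.mul ?_)).add
    ((hG.smooth_scalarCurv.div_const _).mul ?_)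
  · exact ((((hG.smooth j l).mul (hG.smooth_ricci k m)).sub
      ((hG.smooth j m).mul (hG.smooth_ricci k l))).add
      ((hG.smooth k m).mul (hG.smooth_ricci j l))).sub
      ((hG.smooth k l).mul (hG.smooth_ricci j m))
  · exact ((hG.smooth j l).mul (hG.smooth k m)).sub ((hG.smooth j m).mul (hG.smooth k l))

/-- The trace of `W` is minus the normalized trace-free Ricci tensor. -/
theorem sum_inv_mul_spatialWeyl (hG : IsMetricOn G U) (hcard : 2 < Fintype.card ι) (hy : y ∈ U)
    (k l : ι) :
    ∑ m, ∑ j, (G y)⁻¹ m j * spatialWeyl G j k l m y = -tracelessRicci G k l y := by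
  have h4 : (2 : ℝ) < Fintype.card ι := by exact_mod_cast hcard
  have t1 : ∑ m, ∑ j, (G y)⁻¹ m j * riemann G j k l m y = -ricci G k l y := by
    rw [ricci, ← Finset.sum_neg_distrib]
    refine Finset.sum_congr rfl fun m _ => ?_
    simp only [riemann_eq_mul]
    rw [hG.sum_inv_mul_metric_mul hy, ← riemannMixed_swap]
    rfl
  have ts : ∀ X : ι → ℝ, ∀ i, ∑ m, ∑ j, (G y)⁻¹ m j * (G y j i * X m) = X i := by
    intro X i
    simp only [← mul_assoc, ← Finset.sum_mul, hG.sum_inv_mul hy]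
    simp
  have ts' : ∀ X : ι → ℝ, ∀ i, ∑ m, ∑ j, (G y)⁻¹ m j * (G y i m * X j) = X i := by
    intro X i
    rw [Finset.sum_comm, ← ts X i]
    refine Finset.sum_congr rfl fun m _ => Finset.sum_congr rfl fun j _ => ?_
    rw [hG.inv_apply_comm hy j m, hG.apply_comm hy i j]
  have tr : ∑ m, ∑ j, (G y)⁻¹ m j * G y j m = Fintype.card ι := by
    simp [hG.sum_inv_mul hy]
  have e : ∀ m j, (G y)⁻¹ m j * spatialWeyl G j k l m y
      = (G y)⁻¹ m j * riemann G j k l m y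
      - (1 / ((Fintype.card ι : ℝ) - 1)) * ((G y)⁻¹ m j * (G y j l * ricci G k m y)
        - ((G y)⁻¹ m j * G y j m) * ricci G k l y + (G y)⁻¹ m j * (G y k m * ricci G j l y)
        - ((G y)⁻¹ m j * ricci G j m y) * G y k l)
      + (scalarCurv G y / ((Fintype.card ι : ℝ) * ((Fintype.card ι : ℝ) - 1))) *
        ((G y)⁻¹ m j * (G y j l * G y k m) - ((G y)⁻¹ m j * G y j m) * G y k l) := by
    intro m j
    unfold spatialWeyl
    ring
  have ts1 := ts (fun m => ricci G k m y) l
  have ts2 := ts' (fun j => ricci G j l y) k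
  have ts3 := ts (fun m => G y k m) l
  have sc : ∑ m, ∑ j, (G y)⁻¹ m j * ricci G j m y = scalarCurv G y := by
    rw [Finset.sum_comm, scalarCurv]
    refine Finset.sum_congr rfl fun m _ => Finset.sum_congr rfl fun j _ => ?_
    rw [hG.inv_apply_comm hy j m]
  simp only [e, Finset.sum_add_distrib, Finset.sum_sub_distrib, ← Finset.mul_sum,
    ← Finset.sum_mul] at *
  simp only [t1, ts1, ts2, ts3, tr, sc, tracelessRicci]
  have h5 : (Fintype.card ι : ℝ) ≠ 0 := by linarith
  have h6 : (Fintype.card ι : ℝ) - 1 ≠ 0 := by linarith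
  field_simp
  ring

end IsMetricOn

namespace IsWarpedOn

variable {d : ℕ} {a : ℝ → ℝ} {I : Set ℝ} {h : (Fin d → ℝ) → Matrix (Fin d) (Fin d) ℝ}
  {V : Set (Fin d → ℝ)} {y : Fin (d + 1) → ℝ}

variable (hw : IsWarpedOn a I h V) (hy : y ∈ warpedDomain I V)

include hw hy

/-! The components of the Weyl tensor of the warped product. -/

theorem weyl_zero_zero (l m : Fin (d + 1)) : weyl (warpedMetric a h) 0 0 l m y = 0 := by
  linarith [hw.isMetricOn.weyl_swap_left hy 0 0 l m]

theorem weyl_right_zero_zero (j k : Fin (d + 1)) : weyl (warpedMetric a h) j k 0 0 y = 0 := by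
  linarith [weyl_swap_right (warpedMetric a h) j k 0 0 y]

/-- The electric part of the Weyl tensor does not depend on time. -/
theorem weyl_zero_succ_zero_succ (hd : 2 < d) (μ ν : Fin d) :
    weyl (warpedMetric a h) 0 μ.succ 0 ν.succ y = tracelessRicci h μ ν (Fin.tail y) := by
  have ha := hw.scale_ne_zero hy
  have hd' : (2 : ℝ) < d := by exact_mod_cast hd
  have h5 : (d : ℝ) ≠ 0 := by linarith
  have h6 : (d : ℝ) - 1 ≠ 0 := by linarith
  have h7 : (d : ℝ) + 1 - 2 = d - 1 := by ring
  have h8 : (d : ℝ) + 1 - 1 = d := by ring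
  simp only [weyl, riemann, tracelessRicci, Fin.sum_univ_succ, warpedMetric_zero_zero,
    warpedMetric_zero_succ, warpedMetric_succ_zero, warpedMetric_succ_succ, hw.ricci_zero_zero hy,
    hw.ricci_succ_succ hy, hw.ricci_zero_succ hy, hw.ricci_succ_zero hy, hw.scalarCurv_eq hy,
    hw.riemannMixed_zero_succ_zero_succ hy, zero_mul, Finset.sum_const_zero, add_zero,
    Fintype.card_fin, Nat.cast_add, Nat.cast_one, h7, h8]
  field_simp
  ring

theorem weyl_zero_succ_succ_succ (μ ν ρ : Fin d) :
    weyl (warpedMetric a h) 0 μ.succ ν.succ ρ.succ y = 0 := by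
  simp [weyl, riemann, Fin.sum_univ_succ, hw.ricci_zero_succ hy,
    hw.riemannMixed_zero_succ_succ_succ hy]

theorem weyl_succ_succ_zero_succ (μ ν ρ : Fin d) :
    weyl (warpedMetric a h) μ.succ ν.succ 0 ρ.succ y = 0 := by
  simp [weyl, riemann, Fin.sum_univ_succ, hw.ricci_succ_zero hy,
    hw.riemannMixed_succ_succ_zero_succ hy]

/-- The spatial part of the Weyl tensor is `a² W`, with `W` independent of time. -/
theorem weyl_succ_succ_succ_succ (hd : 2 < d) (κ μ ν ρ : Fin d) :
    weyl (warpedMetric a h) κ.succ μ.succ ν.succ ρ.succ y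
      = a (y 0) ^ 2 * spatialWeyl h κ μ ν ρ (Fin.tail y) := by
  have ha := hw.scale_ne_zero hy
  have hd' : (2 : ℝ) < d := by exact_mod_cast hd
  have h5 : (d : ℝ) ≠ 0 := by linarith
  have h6 : (d : ℝ) - 1 ≠ 0 := by linarith
  have h7 : (d : ℝ) + 1 - 2 = d - 1 := by ring
  have h8 : (d : ℝ) + 1 - 1 = d := by ring
  have hR : riemann (warpedMetric a h) κ.succ μ.succ ν.succ ρ.succ y
      = a (y 0) ^ 2 * (riemann h κ μ ν ρ (Fin.tail y) + deriv a (y 0) ^ 2 *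
        (h (Fin.tail y) κ ν * h (Fin.tail y) μ ρ - h (Fin.tail y) κ ρ * h (Fin.tail y) μ ν)) := by
    have e : ∀ p, a (y 0) ^ 2 * h (Fin.tail y) κ p *
        (riemannMixed h p μ ν ρ (Fin.tail y) + deriv a (y 0) ^ 2 *
        ((if p = ν then 1 else 0) * h (Fin.tail y) μ ρ
          - (if p = ρ then 1 else 0) * h (Fin.tail y) μ ν))
        = a (y 0) ^ 2 * (h (Fin.tail y) κ p * riemannMixed h p μ ν ρ (Fin.tail y)
          + deriv a (y 0) ^ 2 * ((if p = ν then h (Fin.tail y) κ p else 0) * h (Fin.tail y) μ ρ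
          - (if p = ρ then h (Fin.tail y) κ p else 0) * h (Fin.tail y) μ ν)) := by
      intro p
      split_ifs <;> ring
    simp only [riemann, Fin.sum_univ_succ, warpedMetric_succ_zero, warpedMetric_succ_succ, zero_mul,
      zero_add, hw.riemannMixed_succ_succ_succ_succ hy, e, ← Finset.mul_sum,
      Finset.sum_add_distrib, Finset.sum_sub_distrib, ← Finset.sum_mul, Finset.sum_ite_eq',
      Finset.mem_univ, if_true, hw.metric.apply_comm hy.2 ρ μ, hw.metric.apply_comm hy.2 ν μ]
  rw [weyl, hR, spatialWeyl]
  simp only [warpedMetric_succ_succ, hw.ricci_succ_succ hy, hw.scalarCurv_eq hy,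
    Fintype.card_fin, Nat.cast_add, Nat.cast_one, h7, h8]
  field_simp
  ring

theorem weyl_zero_succ_succ_zero (hd : 2 < d) (μ ν : Fin d) :
    weyl (warpedMetric a h) 0 μ.succ ν.succ 0 y = -tracelessRicci h μ ν (Fin.tail y) := by
  rw [weyl_swap_right, hw.weyl_zero_succ_zero_succ hy hd]

theorem weyl_succ_zero_zero_succ (hd : 2 < d) (μ ν : Fin d) :
    weyl (warpedMetric a h) μ.succ 0 0 ν.succ y = -tracelessRicci h μ ν (Fin.tail y) := by
  rw [hw.isMetricOn.weyl_swap_left hy, hw.weyl_zero_succ_zero_succ hy hd]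

theorem weyl_succ_zero_succ_zero (hd : 2 < d) (μ ν : Fin d) :
    weyl (warpedMetric a h) μ.succ 0 ν.succ 0 y = tracelessRicci h μ ν (Fin.tail y) := by
  rw [weyl_swap_right, hw.weyl_succ_zero_zero_succ hy hd, neg_neg]

theorem weyl_succ_succ_succ_zero (μ ν ρ : Fin d) :
    weyl (warpedMetric a h) μ.succ ν.succ ρ.succ 0 y = 0 := by
  rw [weyl_swap_right, hw.weyl_succ_succ_zero_succ hy, neg_zero]

/-- Both `u^m C_{jklm}` and `u^j u^m C_{jklm}` are given by the trace-free spatial Ricci tensor. -/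
theorem forall_weyl_last_zero_iff (hd : 2 < d) :
    (∀ j k l, weyl (warpedMetric a h) j k l 0 y = 0)
      ↔ ∀ μ ν, tracelessRicci h μ ν (Fin.tail y) = 0 := by
  refine ⟨fun H μ ν => ?_, fun H j k l => ?_⟩
  · rw [← hw.weyl_succ_zero_succ_zero hy hd, H]
  · refine Fin.cases ?_ (fun μ => ?_) j <;> refine Fin.cases ?_ (fun ν => ?_) k <;>
      refine Fin.cases ?_ (fun ρ => ?_) l <;>
    simp [hw.weyl_right_zero_zero hy, hw.weyl_zero_zero hy, hw.weyl_zero_succ_succ_zero hy hd,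
      hw.weyl_succ_zero_succ_zero hy hd, hw.weyl_succ_succ_succ_zero hy, H]

theorem forall_weyl_first_last_zero_iff (hd : 2 < d) :
    (∀ k l, weyl (warpedMetric a h) 0 k l 0 y = 0)
      ↔ ∀ μ ν, tracelessRicci h μ ν (Fin.tail y) = 0 := by
  refine ⟨fun H μ ν => ?_, fun H k l => (hw.forall_weyl_last_zero_iff hy hd).2 H 0 k l⟩
  rw [← neg_neg (tracelessRicci h μ ν (Fin.tail y)), ← hw.weyl_zero_succ_succ_zero hy hd, H,
    neg_zero]

/-- The divergence of the Weyl tensor, with the sum over the block-diagonal inverse metric split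
into its time part and its spatial part. -/
theorem weylDiv_eq (j k l : Fin (d + 1)) : weylDiv (warpedMetric a h) j k l y
    = -covDeriv₄ (warpedMetric a h) (weyl (warpedMetric a h)) 0 j k l 0 y
      + (a (y 0) ^ 2)⁻¹ * ∑ μ : Fin d, ∑ ν : Fin d, (h (Fin.tail y))⁻¹ μ ν *
        covDeriv₄ (warpedMetric a h) (weyl (warpedMetric a h)) ν.succ j k l μ.succ y := by
  simp only [weylDiv, Fin.sum_univ_succ, hw.inv_zero_zero hy, hw.inv_zero_succ hy,
    hw.inv_succ_zero hy, hw.inv_succ_succ hy, zero_mul, Finset.sum_const_zero, add_zero, zero_add,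
    mul_assoc, ← Finset.mul_sum]
  ring

/-- `u^j ∇^m C_{jklm}` is `(n - 3) φ` times the trace-free spatial Ricci tensor. -/
theorem weylDiv_zero_succ_succ (hd : 2 < d) (ρ σ : Fin d) :
    weylDiv (warpedMetric a h) 0 ρ.succ σ.succ y
      = (d - 2) * (deriv a (y 0) / a (y 0)) * tracelessRicci h ρ σ (Fin.tail y) := by
  have ha := hw.scale_ne_zero hy
  have hcard : 2 < Fintype.card (Fin d) := by simpa using hd
  have hFd := fun μ ν => differentiableAt_of_contDiffOn hw.metric.isOpen
    (hw.metric.smooth_tracelessRicci μ ν) hy.2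
  have e0 : covDeriv₄ (warpedMetric a h) (weyl (warpedMetric a h)) 0 0 ρ.succ σ.succ 0 y
      = 2 * (deriv a (y 0) / a (y 0)) * tracelessRicci h ρ σ (Fin.tail y) := by
    unfold covDeriv₄
    rw [hw.partialDeriv_zero_eq hy (c := fun _ => -1) (g := tracelessRicci h ρ σ)
      (fun z hz => by rw [hw.weyl_zero_succ_succ_zero hz hd]; ring) (differentiableAt_const _)
      (hFd ρ σ), Fin.sum_univ_succ]
    simp [hw.christoffel_zero_zero hy, hw.christoffel_succ_zero_zero hy,
      hw.christoffel_succ_zero_succ hy, hw.weyl_zero_succ_succ_zero hy hd,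
      Finset.sum_add_distrib]
    ring
  have e1 : ∀ μ ν : Fin d,
      covDeriv₄ (warpedMetric a h) (weyl (warpedMetric a h)) ν.succ 0 ρ.succ σ.succ μ.succ y
      = -(a (y 0) * deriv a (y 0)) * (spatialWeyl h ν ρ σ μ (Fin.tail y)
        + h (Fin.tail y) ν σ * tracelessRicci h ρ μ (Fin.tail y)
        - h (Fin.tail y) ν μ * tracelessRicci h ρ σ (Fin.tail y)) := by
    intro μ ν
    unfold covDeriv₄
    rw [hw.partialDeriv_eq_zero hy (fun z hz => hw.weyl_zero_succ_succ_succ hz ρ σ μ),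
      Fin.sum_univ_succ]
    simp only [hw.christoffel_zero_succ_zero hy, hw.christoffel_zero_succ_succ hy,
      hw.christoffel_succ_succ_zero hy, hw.weyl_zero_succ_succ_zero hy hd,
      hw.weyl_zero_succ_zero_succ hy hd, hw.weyl_zero_zero hy, hw.weyl_zero_succ_succ_succ hy,
      hw.weyl_succ_succ_succ_succ hy hd, Finset.sum_add_distrib, mul_ite, ite_mul, mul_one,
      mul_zero, zero_mul, Finset.sum_ite_eq', Finset.mem_univ, if_true, Finset.sum_const_zero]
    field_simp
    ring
  have s1 := hw.metric.sum_inv_mul_spatialWeyl hcard hy.2 ρ σ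
  have s2 : ∑ μ, ∑ ν, (h (Fin.tail y))⁻¹ μ ν *
      (h (Fin.tail y) ν σ * tracelessRicci h ρ μ (Fin.tail y))
      = tracelessRicci h ρ σ (Fin.tail y) := by
    simp only [← mul_assoc, ← Finset.sum_mul, hw.metric.sum_inv_mul hy.2]
    simp
  have s3 : ∑ μ, ∑ ν, (h (Fin.tail y))⁻¹ μ ν *
      (h (Fin.tail y) ν μ * tracelessRicci h ρ σ (Fin.tail y))
      = d * tracelessRicci h ρ σ (Fin.tail y) := by
    simp only [← mul_assoc, ← Finset.sum_mul, hw.metric.sum_inv_mul hy.2]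
    simp
  have e2 : ∀ μ ν, (h (Fin.tail y))⁻¹ μ ν * (-(a (y 0) * deriv a (y 0)) *
        (spatialWeyl h ν ρ σ μ (Fin.tail y)
        + h (Fin.tail y) ν σ * tracelessRicci h ρ μ (Fin.tail y)
        - h (Fin.tail y) ν μ * tracelessRicci h ρ σ (Fin.tail y)))
      = -(a (y 0) * deriv a (y 0)) * ((h (Fin.tail y))⁻¹ μ ν * spatialWeyl h ν ρ σ μ (Fin.tail y)
        + (h (Fin.tail y))⁻¹ μ ν * (h (Fin.tail y) ν σ * tracelessRicci h ρ μ (Fin.tail y))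
        - (h (Fin.tail y))⁻¹ μ ν * (h (Fin.tail y) ν μ * tracelessRicci h ρ σ (Fin.tail y))) :=
    fun μ ν => by ring
  rw [hw.weylDiv_eq hy, e0]
  simp only [e1, e2, ← Finset.mul_sum, Finset.sum_add_distrib, Finset.sum_sub_distrib]
  rw [s1, s2, s3]
  field_simp
  ring

omit hy

/-- If the trace-free spatial Ricci tensor vanishes, then so does every component of the Weyl tensor
with a time index. -/
theorem weyl_eq_zero_of_time_index (hd : 2 < d)
    (hF : ∀ x ∈ V, ∀ μ ν, tracelessRicci h μ ν x = 0) (hy : y ∈ warpedDomain I V)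
    {j k l m : Fin (d + 1)} (h0 : j = 0 ∨ k = 0 ∨ l = 0 ∨ m = 0) :
    weyl (warpedMetric a h) j k l m y = 0 := by
  have hL := (hw.forall_weyl_last_zero_iff hy hd).2 (hF _ hy.2)
  have h1 : ∀ k l m, weyl (warpedMetric a h) 0 k l m y = 0 := by
    intro k l m
    refine Fin.cases ?_ (fun μ => ?_) k
    · exact hw.weyl_zero_zero hy l m
    · refine Fin.cases ?_ (fun ν => ?_) l
      · rw [weyl_swap_right, hL, neg_zero]
      · refine Fin.cases ?_ (fun ρ => ?_) m
        · exact hL _ _ _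
        · exact hw.weyl_zero_succ_succ_succ hy μ ν ρ
  rcases h0 with rfl | rfl | rfl | rfl
  · exact h1 _ _ _
  · rw [hw.isMetricOn.weyl_swap_left hy, h1, neg_zero]
  · rw [weyl_swap_right, hL, neg_zero]
  · exact hL _ _ _

/-- If the spatial metric is Einstein, then the Weyl tensor is divergence free. -/
theorem weylDiv_eq_zero (hd : 2 < d)
    (hF : ∀ x ∈ V, ∀ μ ν, tracelessRicci h μ ν x = 0) (hy : y ∈ warpedDomain I V)
    (j k l : Fin (d + 1)) : weylDiv (warpedMetric a h) j k l y = 0 := by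
  have ha := hw.scale_ne_zero hy
  have hcard : 2 < Fintype.card (Fin d) := by simpa using hd
  have hd' : (2 : ℝ) < d := by exact_mod_cast hd
  have hz := fun {z} (hz : z ∈ warpedDomain I V) {j k l m : Fin (d + 1)} =>
    hw.weyl_eq_zero_of_time_index (j := j) (k := k) (l := l) (m := m) hd hF hz
  have hE : ∀ x ∈ V, ∀ μ ν, ricci h μ ν x = scalarCurv h x / Fintype.card (Fin d) * h x μ ν := by
    intro x hx μ ν
    have h1 := hF x hx μ ν
    have h2 : (1 : ℝ) / (Fintype.card (Fin d) - 1) ≠ 0 := by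
      rw [Fintype.card_fin]
      exact one_div_ne_zero (by linarith)
    exact sub_eq_zero.1 ((mul_eq_zero.1 h1).resolve_left h2)
  have hW := fun κ μ ν ρ => differentiableAt_of_contDiffOn hw.metric.isOpen
    (hw.metric.smooth_spatialWeyl κ μ ν ρ) hy.2
  have h0 : ∀ j k l, covDeriv₄ (warpedMetric a h) (weyl (warpedMetric a h)) 0 j k l 0 y = 0 := by
    intro j k l
    unfold covDeriv₄
    rw [hw.partialDeriv_eq_zero hy (fun z hz' => hz hz' (by simp)), zero_sub, neg_eq_zero]
    refine Finset.sum_eq_zero fun p _ => ?_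
    have hp : christoffel (warpedMetric a h) p 0 0 y = 0 := by
      refine Fin.cases ?_ (fun κ => ?_) p
      · exact hw.christoffel_zero_zero hy 0
      · exact hw.christoffel_succ_zero_zero hy κ
    rw [hp, hz hy (by simp), hz hy (by simp), hz hy (by simp)]
    ring
  -- The components with a time index in the first pair.
  have h1 : ∀ ρ l, weylDiv (warpedMetric a h) 0 (Fin.succ ρ) l y = 0 := by
    intro ρ l
    refine Fin.cases ?_ (fun σ => ?_) l
    · rw [hw.weylDiv_eq hy, h0, neg_zero, zero_add, Finset.sum_eq_zero, mul_zero]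
      intro μ _
      refine Finset.sum_eq_zero fun ν _ => ?_
      unfold covDeriv₄
      rw [hw.partialDeriv_eq_zero hy (fun z hz' => hz hz' (by simp)), zero_sub, Finset.sum_eq_zero,
        neg_zero, mul_zero]
      intro p _
      rw [hz hy (by simp), hz hy (by simp), hz hy (by simp), hz hy (by simp)]
      ring
    · rw [hw.weylDiv_zero_succ_succ hy hd, hF _ hy.2, mul_zero]
  refine Fin.cases ?_ (fun μ => ?_) j <;> refine Fin.cases ?_ (fun ν => ?_) k
  · linarith [hw.isMetricOn.weylDiv_swap hy 0 0 l]
  · exact h1 ν l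
  · rw [hw.isMetricOn.weylDiv_swap hy, h1, neg_zero]
  refine Fin.cases ?_ (fun ρ => ?_) l
  · -- Contraction of the symmetric inverse metric with the skew pair of the Weyl tensor.
    have e : ∀ κ σ : Fin d, covDeriv₄ (warpedMetric a h) (weyl (warpedMetric a h)) σ.succ μ.succ
        ν.succ 0 κ.succ y = -(a (y 0) * deriv a (y 0)) * spatialWeyl h μ ν σ κ (Fin.tail y) := by
      intro κ σ
      unfold covDeriv₄
      rw [hw.partialDeriv_eq_zero hy (fun z hz' => hz hz' (by simp)), Fin.sum_univ_succ,
        hz hy (by simp), hz hy (by simp), hz hy (by simp), hz hy (by simp)]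
      have e2 : ∀ p : Fin d, christoffel (warpedMetric a h) p.succ σ.succ μ.succ y
            * weyl (warpedMetric a h) p.succ ν.succ 0 κ.succ y
          + christoffel (warpedMetric a h) p.succ σ.succ ν.succ y
            * weyl (warpedMetric a h) μ.succ p.succ 0 κ.succ y
          + christoffel (warpedMetric a h) p.succ σ.succ 0 y
            * weyl (warpedMetric a h) μ.succ ν.succ p.succ κ.succ y
          + christoffel (warpedMetric a h) p.succ σ.succ κ.succ y
            * weyl (warpedMetric a h) μ.succ ν.succ 0 p.succ y
          = if p = σ then a (y 0) * deriv a (y 0) * spatialWeyl h μ ν p κ (Fin.tail y) else 0 := by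
        intro p
        rw [hz hy (j := p.succ) (l := 0) (by simp), hz hy (k := p.succ) (l := 0) (by simp),
          hz hy (l := 0) (m := p.succ) (by simp),
          hw.christoffel_succ_succ_zero hy, hw.weyl_succ_succ_succ_succ hy hd]
        split_ifs
        · field_simp
          ring
        · ring
      simp only [e2, Finset.sum_ite_eq', Finset.mem_univ, if_true]
      ring
    have hskew : ∀ κ σ, spatialWeyl h μ ν κ σ (Fin.tail y)
        = -spatialWeyl h μ ν σ κ (Fin.tail y) := by
      intro κ σ
      unfold spatialWeyl
      rw [riemann_swap_right h μ ν σ κ]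
      ring
    have s : ∑ κ, ∑ σ, (h (Fin.tail y))⁻¹ κ σ * (-(a (y 0) * deriv a (y 0))
        * spatialWeyl h μ ν σ κ (Fin.tail y)) = 0 := by
      have s2 : ∑ κ, ∑ σ, (h (Fin.tail y))⁻¹ κ σ * (-(a (y 0) * deriv a (y 0))
          * spatialWeyl h μ ν σ κ (Fin.tail y))
          = -∑ κ, ∑ σ, (h (Fin.tail y))⁻¹ κ σ * (-(a (y 0) * deriv a (y 0))
          * spatialWeyl h μ ν σ κ (Fin.tail y)) := by
        conv_lhs => rw [Finset.sum_comm]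
        simp only [← Finset.sum_neg_distrib]
        refine Finset.sum_congr rfl fun κ _ => Finset.sum_congr rfl fun σ _ => ?_
        rw [hw.metric.inv_apply_comm hy.2 σ κ, hskew κ σ]
        ring
      linarith
    rw [hw.weylDiv_eq hy, h0]
    simp only [e, s]
    simp
  · -- The purely spatial components reduce to the divergence of `W` on the Einstein factor.
    have e : ∀ κ σ : Fin d, covDeriv₄ (warpedMetric a h) (weyl (warpedMetric a h)) σ.succ μ.succ
        ν.succ ρ.succ κ.succ y
        = a (y 0) ^ 2 * covDeriv₄ h (spatialWeyl h) σ μ ν ρ κ (Fin.tail y) := by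
      intro κ σ
      unfold covDeriv₄
      rw [hw.partialDeriv_succ_eq hy (c := fun t => a t ^ 2) (g := spatialWeyl h μ ν ρ κ)
        (fun z hz => hw.weyl_succ_succ_succ_succ hz hd μ ν ρ κ)
        (hw.hasDerivAt_sq_scale hy).differentiableAt (hW μ ν ρ κ), Fin.sum_univ_succ,
        hz hy (by simp), hz hy (by simp), hz hy (by simp), hz hy (by simp)]
      simp only [hw.christoffel_succ_succ_succ hy, hw.weyl_succ_succ_succ_succ hy hd, mul_zero,
        add_zero, zero_add]
      rw [mul_sub, Finset.mul_sum]
      congr 1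
      exact Finset.sum_congr rfl fun p _ => by ring
    have s := hw.metric.div_spatialWeyl hcard hE hy.2 μ ν ρ
    rw [hw.weylDiv_eq hy, h0]
    simp only [e, mul_left_comm _ (a (y 0) ^ 2), ← Finset.mul_sum, s]
    simp

end IsWarpedOn

end CoordMetric

/-! ### The chart of a generalized Robertson-Walker space-time -/

namespace GRWSpacetime

open CoordMetric
open scoped Topology

variable {d : ℕ} {M : Type*} [TopologicalSpace M]
  [ChartedSpace (EuclideanSpace ℝ (Fin d)) M] [IsManifold (𝓡 d) ∞ M]

/-- The coordinate vector field `∂/∂x^μ` of the chart `e` at the point with coordinates `x`. -/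
noncomputable def chartFrame (e : OpenPartialHomeomorph M (EuclideanSpace ℝ (Fin d)))
    (x : EuclideanSpace ℝ (Fin d)) (μ : Fin d) : TangentSpace (𝓡 d) (e.symm x) :=
  mfderiv (𝓡 d) (𝓡 d) e.symm x (EuclideanSpace.single μ (1 : ℝ))

/-- The components of the spatial metric `g*` in the chart `e`. -/
noncomputable def spatialComponents (S : GRWSpacetime d M)
    (e : OpenPartialHomeomorph M (EuclideanSpace ℝ (Fin d))) (x : Fin d → ℝ) :
    Matrix (Fin d) (Fin d) ℝ :=
  Matrix.of fun μ ν => S.gStar.inner (e.symm (WithLp.toLp 2 x))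
    (chartFrame e (WithLp.toLp 2 x) μ) (chartFrame e (WithLp.toLp 2 x) ν)

/-- The coordinate domain of the chart `e`, as a set of coordinate tuples. -/
def spatialDomain (e : OpenPartialHomeomorph M (EuclideanSpace ℝ (Fin d))) : Set (Fin d → ℝ) :=
  {x | WithLp.toLp 2 x ∈ e.target}

theorem components_eq (S : GRWSpacetime d M)
    (e : OpenPartialHomeomorph M (EuclideanSpace ℝ (Fin d))) :
    S.components e = warpedMetric S.a (S.spatialComponents e) := by
  funext y
  ext i j
  refine Fin.cases ?_ (fun μ => ?_) i <;> refine Fin.cases ?_ (fun ν => ?_) j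
  · simp [components, metric, coordFrame]
  · simp [components, metric, coordFrame]
  · simp [components, metric, coordFrame]
  · simp only [components, metric, coordFrame, Matrix.of_apply, Fin.cons_succ,
      warpedMetric_succ_succ, mul_zero, neg_zero, zero_add]
    rfl

section Chart

variable {e : OpenPartialHomeomorph M (EuclideanSpace ℝ (Fin d))}
  (he : e ∈ IsManifold.maximalAtlas (𝓡 d) ∞ M)

include he

theorem contMDiffOn_chartFrame (μ : Fin d) :
    ContMDiffOn (𝓡 d) (𝓡 d).tangent ∞
      (fun x => (⟨e.symm x, chartFrame e x μ⟩ : TangentBundle (𝓡 d) M)) e.target := by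
  have : IsManifold (𝓡 d) 1 M := IsManifold.of_le (n := ∞) (by simp)
  have h1 := contMDiffOn_symm_of_mem_maximalAtlas he
  have h2 := h1.contMDiffOn_tangentMapWithin (m := ∞) (by simp) e.open_target.uniqueMDiffOn
  have h3 : ContMDiff (𝓡 d) (𝓡 d).tangent ∞ (fun x : EuclideanSpace ℝ (Fin d) =>
      (⟨x, EuclideanSpace.single μ (1 : ℝ)⟩ : TangentBundle (𝓡 d) (EuclideanSpace ℝ (Fin d)))) :=
    contMDiff_vectorSpace_iff_contDiff (V := fun _ => EuclideanSpace.single μ (1 : ℝ)).2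
      contDiff_const
  have h4 := h2.comp h3.contMDiffOn (s := e.target) (fun x hx => hx)
  refine h4.congr fun x hx => ?_
  simp only [Function.comp, tangentMapWithin, chartFrame]
  rw [mfderivWithin_of_isOpen e.open_target hx]

theorem linearIndependent_chartFrame {x : EuclideanSpace ℝ (Fin d)} (hx : x ∈ e.target)
    (c : Fin d → ℝ) (hc : ∑ μ, c μ • chartFrame e x μ = 0) : c = 0 := by
  have h1 : e.symm.MDifferentiable (𝓡 d) (𝓡 d) :=
    ⟨(contMDiffOn_symm_of_mem_maximalAtlas he).mdifferentiableOn (by simp),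
      (contMDiffOn_of_mem_maximalAtlas he).mdifferentiableOn (by simp)⟩
  have h2 : mfderiv (𝓡 d) (𝓡 d) e.symm x (∑ μ, c μ • EuclideanSpace.single μ (1 : ℝ))
      = ∑ μ, c μ • chartFrame e x μ := by
    refine (map_sum (mfderiv (𝓡 d) (𝓡 d) e.symm x) _ _).trans ?_
    exact Finset.sum_congr rfl fun μ _ => map_smul (mfderiv (𝓡 d) (𝓡 d) e.symm x) _ _
  have h3 : (∑ μ, c μ • EuclideanSpace.single μ (1 : ℝ)) = 0 :=
    h1.mfderiv_injective hx ((h2.trans hc).trans (map_zero _).symm)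
  funext ν
  have h4 := congrArg (fun v : EuclideanSpace ℝ (Fin d) => v ν) h3
  simpa [Pi.single_apply] using h4

theorem isMetricOn_spatialComponents (S : GRWSpacetime d M) :
    IsMetricOn (S.spatialComponents e) (spatialDomain e) where
  isOpen := e.open_target.preimage (PiLp.continuous_toLp 2 _)
  smooth := by
    intro μ ν
    have h2 : ContDiffOn ℝ ∞ (fun x => S.gStar.inner (e.symm x) (chartFrame e x μ)
        (chartFrame e x ν)) e.target := by
      rw [← contMDiffOn_iff_contDiffOn]
      intro x hx
      have h3 : ContMDiffWithinAt (𝓡 d) ((𝓡 d).prod 𝓘(ℝ)) ∞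
          (fun x => Bundle.TotalSpace.mk' ℝ (E := Bundle.Trivial M ℝ) (e.symm x)
            (S.gStar.inner (e.symm x) (chartFrame e x μ) (chartFrame e x ν))) e.target x := by
        apply ContMDiffWithinAt.clm_bundle_apply₂ (F₁ := EuclideanSpace ℝ (Fin d))
          (F₂ := EuclideanSpace ℝ (Fin d))
        · exact ContMDiffAt.comp_contMDiffWithinAt x S.gStar.contMDiff.contMDiffAt
            (contMDiffOn_symm_of_mem_maximalAtlas he x hx)
        · exact contMDiffOn_chartFrame he μ x hx
        · exact contMDiffOn_chartFrame he ν x hx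
      rw [Bundle.contMDiffWithinAt_totalSpace] at h3
      exact h3.2
    exact h2.comp (PiLp.contDiff_toLp).contDiffOn fun x hx => hx
  symm := by
    intro x _
    ext μ ν
    exact S.gStar.symm _ _ _
  isUnit_det := by
    intro x hx
    rw [isUnit_iff_ne_zero]
    intro hdet
    obtain ⟨c, hc0, hc⟩ := Matrix.exists_mulVec_eq_zero_iff.2 hdet
    refine hc0 (linearIndependent_chartFrame he hx c ?_)
    by_contra hv
    refine (S.gStar.pos _ _ hv).ne' ?_
    have h1 : ∀ μ, S.gStar.inner (e.symm (WithLp.toLp 2 x)) (chartFrame e (WithLp.toLp 2 x) μ)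
        (∑ ν, c ν • chartFrame e (WithLp.toLp 2 x) ν) = 0 := by
      intro μ
      have h2 := congrFun hc μ
      simp only [Matrix.mulVec, dotProduct, spatialComponents, Matrix.of_apply, Pi.zero_apply] at h2
      rw [map_sum, ← h2]
      refine Finset.sum_congr rfl fun ν _ => ?_
      rw [map_smul, smul_eq_mul, mul_comm]
    rw [S.gStar.symm, map_sum]
    refine Finset.sum_eq_zero fun μ _ => ?_
    rw [map_smul, S.gStar.symm, h1, smul_zero]

theorem isWarpedOn (S : GRWSpacetime d M) :
    IsWarpedOn S.a S.I (S.spatialComponents e) (spatialDomain e) where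
  isOpen_time := S.isOpen_I
  smooth_scale := S.contDiffOn_a
  scale_pos := S.a_pos
  metric := isMetricOn_spatialComponents he S

end Chart

theorem sum_u_mul (f : Fin (d + 1) → ℝ) : ∑ j, u j * f j = f 0 := by
  simp [u]

theorem uLower_eq (S : GRWSpacetime d M)
    (e : OpenPartialHomeomorph M (EuclideanSpace ℝ (Fin d))) (k : Fin (d + 1)) :
    S.uLower e k = fun _ => if k = 0 then -1 else 0 := by
  funext y
  simp only [uLower, mul_comm _ (u _), sum_u_mul, components_eq]
  refine Fin.cases ?_ (fun μ => ?_) k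
  · simp
  · simp [Fin.succ_ne_zero]

theorem unitTimelike (S : GRWSpacetime d M) : S.UnitTimelike := by
  intro e _ y _
  rw [sum_u_mul, uLower_eq]
  simp

theorem torseForming (S : GRWSpacetime d M) : S.TorseForming := by
  intro e he y hy j k
  have hw := isWarpedOn he S
  have ha := hw.scale_ne_zero hy
  have hy' : time y = y 0 := rfl
  simp only [covDeriv₁, uLower_eq, components_eq, partialDeriv_const, hy']
  rw [Fin.sum_univ_succ]
  refine Fin.cases ?_ (fun μ => ?_) j <;> refine Fin.cases ?_ (fun ν => ?_) k
  · simp [hw.christoffel_zero_zero hy]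
  · simp [hw.christoffel_zero_zero hy, Fin.succ_ne_zero]
  · simp [hw.christoffel_zero_succ_zero hy, Fin.succ_ne_zero]
  · simp [hw.christoffel_zero_succ_succ hy, Fin.succ_ne_zero]
    field_simp

theorem ricciEigenvector (S : GRWSpacetime d M) : S.RicciEigenvector := by
  intro e he y hy
  have hw := isWarpedOn he S
  refine ⟨d * (deriv (deriv S.a) (y 0) / S.a (y 0)), fun k => ?_⟩
  simp only [mul_comm _ (u _), sum_u_mul, components_eq, uLower_eq]
  refine Fin.cases ?_ (fun μ => ?_) k
  · simp [hw.ricci_zero_zero hy]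
  · simp [hw.ricci_succ_zero hy, Fin.succ_ne_zero]

/-- The spatial metric is Einstein: its trace-free Ricci tensor vanishes in every chart. -/
def SpatiallyEinstein (S : GRWSpacetime d M) : Prop :=
  ∀ e ∈ IsManifold.maximalAtlas (𝓡 d) ∞ M, ∀ x ∈ spatialDomain e, ∀ μ ν,
    tracelessRicci (S.spatialComponents e) μ ν x = 0

/-- Each spatial coordinate point is the spatial part of an event, at any time in `I`. -/
theorem cons_mem_coordDomain (S : GRWSpacetime d M)
    {e : OpenPartialHomeomorph M (EuclideanSpace ℝ (Fin d))} {t : ℝ} (ht : t ∈ S.I)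
    {x : Fin d → ℝ} (hx : x ∈ spatialDomain e) :
    (Fin.cons t x : Fin (d + 1) → ℝ) ∈ S.coordDomain e :=
  ⟨ht, hx⟩

theorem weylAnnihilated_iff (S : GRWSpacetime d M) (hd : 2 < d) :
    S.WeylAnnihilated ↔ S.SpatiallyEinstein := by
  simp only [WeylAnnihilated, Everywhere, sum_u_mul, components_eq]
  constructor
  · intro H e he x hx
    obtain ⟨t, ht⟩ := S.nonempty_I
    have hy := S.cons_mem_coordDomain ht hx
    exact ((isWarpedOn he S).forall_weyl_last_zero_iff hy hd).1 (H e he _ hy)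
  · intro H e he y hy
    exact ((isWarpedOn he S).forall_weyl_last_zero_iff hy hd).2 (H e he _ hy.2)

theorem contractedWeylZero_iff (S : GRWSpacetime d M) (hd : 2 < d) :
    S.ContractedWeylZero ↔ S.SpatiallyEinstein := by
  simp only [ContractedWeylZero, Everywhere, mul_assoc, ← Finset.mul_sum, sum_u_mul, components_eq]
  constructor
  · intro H e he x hx
    obtain ⟨t, ht⟩ := S.nonempty_I
    have hy := S.cons_mem_coordDomain ht hx
    exact ((isWarpedOn he S).forall_weyl_first_last_zero_iff hy hd).1 (H e he _ hy)
  · intro H e he y hy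
    exact ((isWarpedOn he S).forall_weyl_first_last_zero_iff hy hd).2 (H e he _ hy.2)

theorem SpatiallyEinstein.weylDivFree {S : GRWSpacetime d M} (hd : 2 < d)
    (H : S.SpatiallyEinstein) : S.WeylDivFree := by
  intro e he y hy j k l
  rw [components_eq]
  exact (isWarpedOn he S).weylDiv_eq_zero hd (H e he) hy j k l

theorem WeylDivFree.contractedWeylDivZero {S : GRWSpacetime d M} (H : S.WeylDivFree) :
    S.ContractedWeylDivZero := by
  intro e he y hy k l
  rw [sum_u_mul]
  exact H e he y hy 0 k l

/-- A nonconstant scale function has a nonzero derivative at some time. -/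
theorem exists_deriv_scale_ne_zero (S : GRWSpacetime d M)
    (hne : ∃ s ∈ S.I, ∃ t ∈ S.I, S.a s ≠ S.a t) : ∃ t ∈ S.I, deriv S.a t ≠ 0 := by
  obtain ⟨s, hs, t, ht, hst⟩ := hne
  by_contra! hc
  refine hst (S.isOpen_I.is_const_of_deriv_eq_zero S.ordConnected_I.isPreconnected
    (S.contDiffOn_a.differentiableOn (by simp)) (fun x hx => hc x hx) hs ht)

theorem ContractedWeylDivZero.spatiallyEinstein {S : GRWSpacetime d M} (hd : 2 < d)
    (hne : ∃ s ∈ S.I, ∃ t ∈ S.I, S.a s ≠ S.a t) (H : S.ContractedWeylDivZero) :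
    S.SpatiallyEinstein := by
  intro e he x hx μ ν
  -- The trace-free spatial Ricci tensor does not depend on time, so one time with `φ ≠ 0` suffices.
  obtain ⟨t, ht, hat⟩ := S.exists_deriv_scale_ne_zero hne
  have hw := isWarpedOn he S
  have hy := S.cons_mem_coordDomain ht hx
  have h1 := H e he _ hy μ.succ ν.succ
  rw [sum_u_mul, components_eq, hw.weylDiv_zero_succ_succ hy hd] at h1
  have hd' : (2 : ℝ) < d := by exact_mod_cast hd
  have h2 : ((d : ℝ) - 2) * (deriv S.a t / S.a t) ≠ 0 :=
    mul_ne_zero (by linarith) (div_ne_zero hat (S.a_pos t ht).ne')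
  exact (mul_eq_zero.1 h1).resolve_left h2

end GRWSpacetime

theorem mainTheorem1 {d : ℕ} (hd : 3 < d + 1) {M : Type*} [TopologicalSpace M]
    [ChartedSpace (EuclideanSpace ℝ (Fin d)) M] [IsManifold (𝓡 d) ∞ M]
    (S : GRWSpacetime d M) :
    (S.UnitTimelike ∧ S.TorseForming ∧ S.RicciEigenvector) ∧
    ((S.WeylAnnihilated ↔ S.ContractedWeylZero) ∧
      (S.ContractedWeylZero → S.WeylDivFree) ∧
      (S.WeylDivFree → S.ContractedWeylDivZero)) ∧
    ((∃ s ∈ S.I, ∃ t ∈ S.I, S.a s ≠ S.a t) →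
      List.TFAE [S.WeylDivFree, S.WeylAnnihilated, S.ContractedWeylZero,
        S.ContractedWeylDivZero]) := by
  have hd2 : 2 < d := by omega
  have h23 : S.WeylAnnihilated ↔ S.ContractedWeylZero :=
    (S.weylAnnihilated_iff hd2).trans (S.contractedWeylZero_iff hd2).symm
  have h31 : S.ContractedWeylZero → S.WeylDivFree := fun H =>
    ((S.contractedWeylZero_iff hd2).1 H).weylDivFree hd2
  have h14 : S.WeylDivFree → S.ContractedWeylDivZero := fun H => H.contractedWeylDivZero
  refine ⟨⟨S.unitTimelike, S.torseForming, S.ricciEigenvector⟩, ⟨h23, h31, h14⟩, fun hne => ?_⟩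
  have h43 : S.ContractedWeylDivZero → S.ContractedWeylZero := fun H =>
    (S.contractedWeylZero_iff hd2).2 (H.spatiallyEinstein hd2 hne)
  tfae_have 2 ↔ 3 := h23
  tfae_have 3 → 1 := h31
  tfae_have 1 → 4 := h14
  tfae_have 4 → 3 := h43
  tfae_finish
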